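/- Let $a,c\in\mathbb R$ satisfy $c<-a-c<a$, put $\mathcal B=(a^2+c^2+ac)/3$, and let $(y,\eta)$ satisfy $y\in[c,-a-c]$ and $\eta^2/2-y^3/3+\mathcal B y=ac(a+c)/3$. Let $x_0$ be the solution on $[0,\infty)$ of $\ddot x_0=x_0^2-\mathcal B$, $x_0(0)=y$, $\dot x_0(0)=\eta$. Let $B$ be a standard one-dimensional Brownian motion on a probability space $(\Omega,\mathcal F,\mathbb P)$. Let $x_1$ be the strong solution, adapted to the (augmented) Brownian filtration, of $\ddot x_1=2x_0x_1+\dot B$, $x_1(0)=\dot x_1(0)=0$, i.e. of the system $dx_1=\xi_1\,dt$, $d\xi_1=2x_0x_1\,dt+dB$, $x_1(0)=\xi_1(0)=0$; and for $n\ge2$ let $x_n$ be the adapted solution of $\ddot x_n=2x_0x_n+\sum_{j=1}^{n-1}x_jx_{n-j}$, $x_n(0)=\dot x_n(0)=0$. Let $q=\sqrt{(2c+a)/(c-a)}\in(0,1)$, $F(\varphi,q)=\int_0^\varphi(1-q^2\sin^2\alpha)^{-1/2}d\alpha$, let $\mathrm{sn},\mathrm{cn},\mathrm{dn}$ be the Jacobi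 elliptic functions of modulus $q$, and let $\mathcal E(t)=\int_0^t\mathrm{dn}^2(s)\,ds$. Put $$u_1=\mathrm{sn}\,\mathrm{cn}\,\mathrm{dn},$$ $$u_2(t)=(q^2-1)+(-2q^6+3q^4-5q^2+2)\,\mathrm{cn}^2(t)+2q^2(q^4-q^2+1)\,\mathrm{cn}^4(t)+\big[(-q^4+3q^2-2)t+2(q^4-q^2+1)\mathcal E(t)\big]u_1(t).$$ Let $i_y=F\big(\arcsin\sqrt{(c-y)/(2c+a)},q\big)$, and let $\iota=i_y$ if $\eta\ge0$, $\iota=-i_y$ if $\eta<0$. Let $w_k(t)=\kappa_k\,u_k\big(\sqrt{(a-c)/6}\,t+\iota\big)$ for $k=1,2$, where $\kappa_1,\kappa_2$ are any real constants normalising the Wronskian $w_1\dot w_2-\dot w_1w_2$ to $1$, i.e. $-\kappa_1\kappa_2\sqrt{(a-c)/6}\,(1-q^2)^2=1$ (so $w_1,w_2$ are independent solutions of $\ddot w=2x_0w$). Let $\mathcal K(t,s)=w_2(t)w_1(s)-w_1(t)w_2(s)$, and define $\gamma_1=|w_1|+|w_2|$, $$\gamma_n(t)=\int_0^t|\mathcal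 K(t,s)|\sum_{j=1}^{n-1}\gamma_j(s)\gamma_{n-j}(s)\,ds\quad(n\ge2),\qquad \Gamma_n=\sum_{i=1}^n\gamma_i .$$ Let $\sigma>0$, $n\ge1$ and $X_n^\sigma=x_0+\sigma x_1+\dots+\sigma^nx_n$. Then for every $T>0$ the set $\{|X_n^\sigma(t)-x_0(t)|\le\Gamma_n(t)\text{ for all }t\in[0,T]\}$ is an event (measurable up to a $\mathbb P$-null set) and $$\mathbb P\Big(|X_n^\sigma(t)-x_0(t)|\le\Gamma_n(t)\ \text{for all }t\in[0,T]\Big)\ \ge\ 1-\sigma\,2^{(n-1)^+}\sqrt{2/\pi}\,\Big(\|w_1\|_{L^2([0,T])}+\|w_2\|_{L^2([0,T])}\Big).$$ -/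

import Mathlib

open MeasureTheory ProbabilityTheory Set
open scoped NNReal ENNReal

namespace AnharmonicOscillator

noncomputable section

/-! ### Jacobi elliptic functions -/

/-- The elliptic integral of the first kind `F(φ, q) = ∫₀^φ dα / √(1 - q² sin² α)`. -/
def ellipticF (φ q : ℝ) : ℝ := ∫ α in (0 : ℝ)..φ, 1 / √(1 - q ^ 2 * Real.sin α ^ 2)

/-- The Jacobi amplitude: the inverse function of `φ ↦ F(φ, q)`, which is a bijection of `ℝ`
for `0 ≤ q < 1`. -/
def am (u q : ℝ) : ℝ := Function.invFun (fun φ : ℝ => ellipticF φ q) u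

/-- The Jacobi elliptic sine. -/
def sn (u q : ℝ) : ℝ := Real.sin (am u q)

/-- The Jacobi elliptic cosine. -/
def cn (u q : ℝ) : ℝ := Real.cos (am u q)

/-- The Jacobi delta amplitude. -/
def dn (u q : ℝ) : ℝ := √(1 - q ^ 2 * sn u q ^ 2)

/-- Jacobi's Epsilon function. -/
def jacobiEpsilon (u q : ℝ) : ℝ := ∫ t in (0 : ℝ)..u, dn t q ^ 2

/-! ### The unperturbed oscillator -/

/-- The Hamiltonian of the cubic anharmonic oscillator. -/
def hamiltonian (𝓑 x ξ : ℝ) : ℝ := ξ ^ 2 / 2 - x ^ 3 / 3 + 𝓑 * x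

/-- `x₀` solves `ẍ₀ = x₀² - 𝓑`, `x₀(0) = y`, `ẋ₀(0) = η` on `[0, ∞)`. -/
def IsDeterministicSolution (𝓑 y η : ℝ) (x₀ : ℝ → ℝ) : Prop :=
  ∃ ξ₀ : ℝ → ℝ, x₀ 0 = y ∧ ξ₀ 0 = η ∧
    ∀ t, 0 ≤ t → HasDerivWithinAt x₀ (ξ₀ t) (Ici 0) t ∧
      HasDerivWithinAt ξ₀ (x₀ t ^ 2 - 𝓑) (Ici 0) t

/-- The constant `𝓑` for which `x³/3 - 𝓑 x + a c (a + c)/3` has the roots `c`, `-a-c`, `a`. -/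
def bConst (a c : ℝ) : ℝ := (a ^ 2 + c ^ 2 + a * c) / 3

/-- The modulus `q = √((2c + a)/(c - a))`. -/
def modulus (a c : ℝ) : ℝ := √((2 * c + a) / (c - a))

/-- The phase: `i_y = F(arcsin √((c - y)/(2c + a)), q)` when the initial velocity `η` is
nonnegative, and `-i_y` when it is negative. -/
def phase (a c y η : ℝ) : ℝ :=
  if 0 ≤ η then ellipticF (Real.arcsin √((c - y) / (2 * c + a))) (modulus a c)
  else -ellipticF (Real.arcsin √((c - y) / (2 * c + a))) (modulus a c)

/-! ### Two solutions of the Lamé equation -/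

/-- `u₁ = sn cn dn`. -/
def u₁ (q t : ℝ) : ℝ := sn t q * cn t q * dn t q

/-- `u₂ = α₀ + α₁ cn² + α₂ cn⁴ + (β₀ t + β₁ ℰ(t)) u₁`. -/
def u₂ (q t : ℝ) : ℝ :=
  (-1 + q ^ 2) + (-2 * q ^ 6 + 3 * q ^ 4 - 5 * q ^ 2 + 2) * cn t q ^ 2
    + 2 * q ^ 2 * (q ^ 4 - q ^ 2 + 1) * cn t q ^ 4
    + ((-q ^ 4 + 3 * q ^ 2 - 2) * t + 2 * (q ^ 4 - q ^ 2 + 1) * jacobiEpsilon t q) * u₁ q t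

/-- `w₁(t) = κ₁ u₁(√((a - c)/6) t + phase)`, where `κ₁` is a normalising constant. -/
def w₁ (a c y η κ₁ t : ℝ) : ℝ :=
  κ₁ * u₁ (modulus a c) (√((a - c) / 6) * t + phase a c y η)

/-- `w₂(t) = κ₂ u₂(√((a - c)/6) t + phase)`, where `κ₂` is a normalising constant. -/
def w₂ (a c y η κ₂ t : ℝ) : ℝ :=
  κ₂ * u₂ (modulus a c) (√((a - c) / 6) * t + phase a c y η)

/-- The kernel `𝒦(t, s) = w₂(t) w₁(s) - w₁(t) w₂(s)` of a pair of functions. -/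
def kernelK (w w' : ℝ → ℝ) (t s : ℝ) : ℝ := w' t * w s - w t * w' s

/-- The functions `γ₁ = |w| + |w'|` and
`γₙ(t) = ∫₀ᵗ |𝒦(t, s)| ∑_{j=1}^{n-1} γⱼ(s) γₙ₋ⱼ(s) ds` for `n ≥ 2`; the sum over
`1 ≤ j ≤ n - 1` is written with the index `j - 1 : Fin (n - 1)`. The value at `n = 0` is not
used. -/
def gammaBound (w w' : ℝ → ℝ) : ℕ → ℝ → ℝ
  | 0 => fun _ => 0
  | 1 => fun t => |w t| + |w' t|
  | n + 2 => fun t => ∫ s in (0 : ℝ)..t, |kernelK w w' t s| *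
      ∑ j : Fin (n + 1), gammaBound w w' (j.1 + 1) s * gammaBound w w' (n + 1 - j.1) s
termination_by n => n
decreasing_by all_goals omega

/-- The recursion for `γₙ`, with the sum in its usual form. -/
theorem gammaBound_of_two_le (w w' : ℝ → ℝ) (n : ℕ) (hn : 2 ≤ n) (t : ℝ) :
    gammaBound w w' n t = ∫ s in (0 : ℝ)..t, |kernelK w w' t s| *
      ∑ j ∈ Finset.Icc 1 (n - 1), gammaBound w w' j s * gammaBound w w' (n - j) s := by
  obtain ⟨m, rfl⟩ := Nat.exists_eq_add_of_le' hn
  rw [gammaBound]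
  refine intervalIntegral.integral_congr fun s _ => ?_
  congr 1
  rw [Fin.sum_univ_eq_sum_range
    (fun j => gammaBound w w' (j + 1) s * gammaBound w w' (m + 1 - j) s) (m + 1)]
  have h : Finset.Icc 1 (m + 2 - 1) = Finset.Ico 1 (m + 2) := by
    ext j
    simp only [Finset.mem_Icc, Finset.mem_Ico]
    omega
  rw [h, Finset.sum_Ico_eq_sum_range]
  refine Finset.sum_congr rfl fun j _ => ?_
  have h2 : m + 2 - (1 + j) = m + 1 - j := by omega
  rw [h2, add_comm 1 j]

/-- `Γₙ = γ₁ + ⋯ + γₙ`. -/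
def gammaSum (w w' : ℝ → ℝ) (n : ℕ) (t : ℝ) : ℝ :=
  ∑ i ∈ Finset.Icc 1 n, gammaBound w w' i t

/-- The norm of `L²([0, T])`. -/
def l2Norm (f : ℝ → ℝ) (T : ℝ) : ℝ := (eLpNorm f 2 (volume.restrict (Icc 0 T))).toReal

/-! ### The coefficients of the expansion -/

/-- The `σ`-algebra generated by `B s`, `s ≤ t`. -/
abbrev brownianSigma {Ω : Type*} (B : ℝ≥0 → Ω → ℝ) (t : ℝ≥0) : MeasurableSpace Ω :=
  ⨆ s : Iic t, MeasurableSpace.comap (B s) inferInstance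

/-- The process `x(t)`, `t ≥ 0`, is adapted to the Brownian filtration (up to null sets). -/
def IsBrownianAdapted {Ω : Type*} {mΩ : MeasurableSpace Ω} (P : Measure Ω)
    (B : ℝ≥0 → Ω → ℝ) (x : ℝ → Ω → ℝ) : Prop :=
  ∀ t : ℝ≥0, AEStronglyMeasurable[brownianSigma B t] (x t) P

/-- `x` is a global strong solution of `ẍ(t) = f(t, x(t)) + θ Ḃ(t)`, `x(0) = ẋ(0) = 0`, that is,
of the system `dx = ξ dt`, `dξ = f(t, x) dt + θ dB`, `x(0) = ξ(0) = 0`, where the drift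
`f(t, x, ω)` may be random: `x` and `ξ` are adapted to the Brownian filtration and,
almost surely, have continuous paths and satisfy the integrated equations at all times. -/
def IsStrongSolution {Ω : Type*} {mΩ : MeasurableSpace Ω} (P : Measure Ω)
    (B : ℝ≥0 → Ω → ℝ) (f : ℝ → ℝ → Ω → ℝ) (θ : ℝ) (x : ℝ → Ω → ℝ) : Prop :=
  ∃ ξ : ℝ → Ω → ℝ, IsBrownianAdapted P B x ∧ IsBrownianAdapted P B ξ ∧
    ∀ᵐ ω ∂P, ContinuousOn (fun t => x t ω) (Ici 0) ∧ ContinuousOn (fun t => ξ t ω) (Ici 0) ∧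
      ∀ t : ℝ≥0, x t ω = (∫ s in (0 : ℝ)..t, ξ s ω) ∧
        ξ t ω = (∫ s in (0 : ℝ)..t, f s (x s ω) ω) + θ * B t ω

/-- `x 1, x 2, …` are the coefficient processes of the formal expansion in powers of `σ`:
`ẍ₁ = 2 x₀ x₁ + Ḃ` and, for `n ≥ 2`, `ẍₙ = 2 x₀ xₙ + ∑_{j=1}^{n-1} xⱼ xₙ₋ⱼ`, all with zero
initial data. The value of `x` at index `0` is not used. -/
structure IsExpansion {Ω : Type*} {mΩ : MeasurableSpace Ω} (P : Measure Ω)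
    (B : ℝ≥0 → Ω → ℝ) (x₀ : ℝ → ℝ) (x : ℕ → ℝ → Ω → ℝ) : Prop where
  first : IsStrongSolution P B (fun t u _ => 2 * x₀ t * u) 1 (x 1)
  higher : ∀ n, 2 ≤ n → IsStrongSolution P B
    (fun t u ω => 2 * x₀ t * u + ∑ j ∈ Finset.Icc 1 (n - 1), x j t ω * x (n - j) t ω) 0 (x n)

/-- The truncated expansion `X_n^σ = x₀ + σ x₁ + ⋯ + σⁿ xₙ`. -/
def truncated {Ω : Type*} (x₀ : ℝ → ℝ) (x : ℕ → ℝ → Ω → ℝ) (σ : ℝ) (n : ℕ) (t : ℝ) (ω : Ω) : ℝ :=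
  x₀ t + ∑ i ∈ Finset.Icc 1 n, σ ^ i * x i t ω

end

end AnharmonicOscillator

namespace AnharmonicOscillator

/-! ### Jacobi elliptic functions: derivatives -/

section Jacobi

variable {q : ℝ}

/-! The estimate combines a homogeneity argument on each path with one maximal inequality. Write
`J_k(t) = ∫₀ᵗ w_k dB`. Since `w₁`, `w₂` solve the linearised equation with Wronskian `1`, variation
of constants gives `x₁ = w₂ J₁ - w₁ J₂`, and for `n ≥ 2` it expresses `xₙ` as the integral of `𝒦(t,
s)` against `∑ xⱼ xₙ₋ⱼ` (`eq_pathIntegral_sub`, `eq_integral_kernelK`). If `|J₁|` and `|J₂|` stay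
below `1/σ` on `[0, T]`, then `|x₁| ≤ σ⁻¹ γ₁`. The recursion is homogeneous of degree `n`, so `|xₙ|
≤ σ⁻ⁿ γₙ` (`abs_le_pow_mul_gammaBound`). The powers of `σ` cancel in the truncated series, and its
deviation from `x₀` is at most `Γₙ`.

The exceptional event is thus contained, up to a null set, in the union of the events `sup |J_k| >
1/σ`. Doob's inequality bounds each probability by `σ E|J_k(T)| = σ √(2/π) ‖w_k‖`, because `J_k(T)`
is a centred Gaussian with variance `‖w_k‖²` (`measure_exists_lt_abs_pathIntegral`). No stochastic
calculus is needed: integration by parts defines `J_k` path by path, Doob's inequality is applied to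
Riemann sums, which are sums of independent Gaussians, and the mesh tends to zero.

That `w₁`, `w₂` are such solutions follows from `x₀ = c - (2c + a) sn²`, which turns `2 x₀` into a
Lamé potential (`exists_derivs_w`). -/

lemma one_sub_sq_mul_sin_sq_pos (hq : q ^ 2 < 1) (α : ℝ) : 0 < 1 - q ^ 2 * Real.sin α ^ 2 := by
  nlinarith [Real.sin_sq_le_one α, sq_nonneg q, sq_nonneg (Real.sin α)]

lemma continuous_ellipticF_integrand (hq : q ^ 2 < 1) :
    Continuous fun α : ℝ => 1 / √(1 - q ^ 2 * Real.sin α ^ 2) := by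
  refine continuous_const.div (by fun_prop) fun α => ?_
  exact (Real.sqrt_pos.2 (one_sub_sq_mul_sin_sq_pos hq α)).ne'

lemma hasDerivAt_ellipticF (hq : q ^ 2 < 1) (φ : ℝ) :
    HasDerivAt (fun φ => ellipticF φ q) (1 / √(1 - q ^ 2 * Real.sin φ ^ 2)) φ :=
  (continuous_ellipticF_integrand hq).integral_hasStrictDerivAt 0 φ |>.hasDerivAt

lemma ellipticF_zero : ellipticF 0 q = 0 := by simp [ellipticF]

lemma strictMono_ellipticF (hq : q ^ 2 < 1) : StrictMono fun φ => ellipticF φ q :=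
  strictMono_of_hasDerivAt_pos (hasDerivAt_ellipticF hq) fun φ =>
    one_div_pos.2 (Real.sqrt_pos.2 (one_sub_sq_mul_sin_sq_pos hq φ))

/-- The integrand of `F` is at least `1`. Hence `F` dominates the identity on the positive axis and
lies below it on the negative one, which yields surjectivity. -/
lemma monotone_ellipticF_sub_id (hq : q ^ 2 < 1) : Monotone fun φ => ellipticF φ q - φ := by
  refine monotone_of_hasDerivAt_nonneg
    (fun φ => (hasDerivAt_ellipticF hq φ).sub (hasDerivAt_id φ)) fun φ => ?_
  have hpos := one_sub_sq_mul_sin_sq_pos hq φ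
  have hle : √(1 - q ^ 2 * Real.sin φ ^ 2) ≤ 1 :=
    Real.sqrt_le_one.2 (by nlinarith [sq_nonneg (q * Real.sin φ)])
  have := (one_le_div (Real.sqrt_pos.2 hpos)).2 hle
  simpa using this

lemma surjective_ellipticF (hq : q ^ 2 < 1) : Function.Surjective fun φ => ellipticF φ q := by
  have hc : Continuous fun φ => ellipticF φ q :=
    continuous_iff_continuousAt.2 fun φ => (hasDerivAt_ellipticF hq φ).continuousAt
  have hm := monotone_ellipticF_sub_id hq
  refine hc.surjective ?_ ?_
  · refine Filter.tendsto_atTop_mono' _ ?_ Filter.tendsto_id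
    filter_upwards [Filter.eventually_ge_atTop 0] with φ hφ
    have := hm hφ
    simp only [ellipticF_zero] at this
    simp only [id]
    linarith
  · refine Filter.tendsto_atBot_mono' _ ?_ Filter.tendsto_id
    filter_upwards [Filter.eventually_le_atBot 0] with φ hφ
    have := hm hφ
    simp only [ellipticF_zero] at this
    simp only [id]
    linarith

lemma ellipticF_am (hq : q ^ 2 < 1) (u : ℝ) : ellipticF (am u q) q = u :=
  Function.rightInverse_invFun (surjective_ellipticF hq) u

lemma am_ellipticF (hq : q ^ 2 < 1) (φ : ℝ) : am (ellipticF φ q) q = φ :=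
  Function.leftInverse_invFun (strictMono_ellipticF hq).injective φ

/-- A monotone surjection of `ℝ` is continuous; the derivative of the inverse function requires this
continuity first. -/
lemma continuous_am (hq : q ^ 2 < 1) : Continuous fun u => am u q := by
  have hmono : Monotone fun u => am u q := fun u v huv => by
    have := (strictMono_ellipticF hq).le_iff_le (a := am u q) (b := am v q)
    simp only [ellipticF_am hq] at this
    exact this.1 huv
  exact hmono.continuous_of_surjective fun φ => ⟨ellipticF φ q, am_ellipticF hq φ⟩

lemma dn_pos (hq : q ^ 2 < 1) (u : ℝ) : 0 < dn u q :=
  Real.sqrt_pos.2 (one_sub_sq_mul_sin_sq_pos hq _)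

lemma dn_sq (hq : q ^ 2 < 1) (u : ℝ) : dn u q ^ 2 = 1 - q ^ 2 * sn u q ^ 2 :=
  Real.sq_sqrt (one_sub_sq_mul_sin_sq_pos hq _).le

lemma cn_sq (u q : ℝ) : cn u q ^ 2 = 1 - sn u q ^ 2 := Real.cos_sq' _

lemma hasDerivAt_am (hq : q ^ 2 < 1) (u : ℝ) : HasDerivAt (fun u => am u q) (dn u q) u := by
  have h := HasDerivAt.of_local_left_inverse (continuous_am hq).continuousAt
    (hasDerivAt_ellipticF hq (am u q))
    (one_div_pos.2 (Real.sqrt_pos.2 (one_sub_sq_mul_sin_sq_pos hq _))).ne'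
    (Filter.Eventually.of_forall (ellipticF_am hq))
  simpa [dn, sn] using h

lemma hasDerivAt_sn (hq : q ^ 2 < 1) (u : ℝ) :
    HasDerivAt (fun u => sn u q) (cn u q * dn u q) u :=
  (hasDerivAt_am hq u).sin

lemma hasDerivAt_cn (hq : q ^ 2 < 1) (u : ℝ) :
    HasDerivAt (fun u => cn u q) (-sn u q * dn u q) u :=
  (hasDerivAt_am hq u).cos

lemma hasDerivAt_dn (hq : q ^ 2 < 1) (u : ℝ) :
    HasDerivAt (fun u => dn u q) (-q ^ 2 * sn u q * cn u q) u := by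
  have h := (((hasDerivAt_sn hq u).pow 2).const_mul (q ^ 2)).const_sub 1 |>.sqrt
    (by exact (one_sub_sq_mul_sin_sq_pos hq _).ne')
  refine h.congr_deriv ?_
  have hd := (dn_pos hq u).ne'
  change _ / (2 * dn u q) = _
  field_simp
  simp; ring

lemma hasDerivAt_jacobiEpsilon (hq : q ^ 2 < 1) (u : ℝ) :
    HasDerivAt (fun u => jacobiEpsilon u q) (dn u q ^ 2) u := by
  have hc : Continuous fun t => dn t q ^ 2 :=
    (continuous_iff_continuousAt.2 fun t => (hasDerivAt_dn hq t).continuousAt).pow 2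
  exact (hc.integral_hasStrictDerivAt 0 u).hasDerivAt

lemma hasDerivAt_sn_sq (hq : q ^ 2 < 1) (u : ℝ) :
    HasDerivAt (fun u => sn u q ^ 2) (2 * u₁ q u) u := by
  refine ((hasDerivAt_sn hq u).pow 2).congr_deriv ?_
  simp [u₁]; ring

/-- With `S = sn²`, one has `S' = 2 u₁`, `u₁'` is a polynomial in `S`, and this relation eliminates
`u₁²`. The Lamé computations below thereby become polynomial identities in `S`, `u₁` and Jacobi's
Epsilon function. -/
lemma u₁_sq (hq : q ^ 2 < 1) (u : ℝ) :
    u₁ q u ^ 2 = sn u q ^ 2 * (1 - sn u q ^ 2) * (1 - q ^ 2 * sn u q ^ 2) := by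
  rw [u₁, mul_pow, mul_pow, cn_sq, dn_sq hq]

end Jacobi

/-! ### The Lamé equation -/

section Lame

variable {q : ℝ}

/-- The derivative of `u₁`. -/
noncomputable def u₁Deriv (q t : ℝ) : ℝ :=
  1 - 2 * (1 + q ^ 2) * sn t q ^ 2 + 3 * q ^ 2 * (sn t q ^ 2) ^ 2

/-- The derivative of `u₂`. -/
noncomputable def u₂Deriv (q t : ℝ) : ℝ :=
  (-2 * (-2 * q ^ 6 + 3 * q ^ 4 - 5 * q ^ 2 + 2)
      - 8 * q ^ 2 * (q ^ 4 - q ^ 2 + 1) * (1 - sn t q ^ 2)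
      + (-q ^ 4 + 3 * q ^ 2 - 2) + 2 * (q ^ 4 - q ^ 2 + 1) * (1 - q ^ 2 * sn t q ^ 2)) * u₁ q t
    + ((-q ^ 4 + 3 * q ^ 2 - 2) * t + 2 * (q ^ 4 - q ^ 2 + 1) * jacobiEpsilon t q) * u₁Deriv q t

lemma u₂_eq (q t : ℝ) : u₂ q t = (-1 + q ^ 2)
    + (-2 * q ^ 6 + 3 * q ^ 4 - 5 * q ^ 2 + 2) * (1 - sn t q ^ 2)
    + 2 * q ^ 2 * (q ^ 4 - q ^ 2 + 1) * (1 - sn t q ^ 2) ^ 2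
    + ((-q ^ 4 + 3 * q ^ 2 - 2) * t + 2 * (q ^ 4 - q ^ 2 + 1) * jacobiEpsilon t q) * u₁ q t := by
  rw [u₂, ← cn_sq]; ring

lemma hasDerivAt_u₁ (hq : q ^ 2 < 1) (t : ℝ) : HasDerivAt (u₁ q) (u₁Deriv q t) t := by
  refine (((hasDerivAt_sn hq t).mul (hasDerivAt_cn hq t)).mul (hasDerivAt_dn hq t)).congr_deriv ?_
  have hc := cn_sq t q
  have hd := dn_sq hq t
  calc _ = cn t q ^ 2 * dn t q ^ 2 - sn t q ^ 2 * dn t q ^ 2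
        - q ^ 2 * sn t q ^ 2 * cn t q ^ 2 := by simp only [Pi.mul_apply]; ring
    _ = _ := by rw [hc, hd, u₁Deriv]; ring

lemma hasDerivAt_u₁Deriv (hq : q ^ 2 < 1) (t : ℝ) :
    HasDerivAt (u₁Deriv q) ((-4 * (1 + q ^ 2) + 12 * q ^ 2 * sn t q ^ 2) * u₁ q t) t := by
  have hS := hasDerivAt_sn_sq hq t
  refine (((hS.const_mul (2 * (1 + q ^ 2))).const_sub 1).add
    ((hS.pow 2).const_mul (3 * q ^ 2))).congr_deriv ?_
  simp; ring

lemma hasDerivAt_lameCoeff (hq : q ^ 2 < 1) (t : ℝ) :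
    HasDerivAt (fun t => (-q ^ 4 + 3 * q ^ 2 - 2) * t
      + 2 * (q ^ 4 - q ^ 2 + 1) * jacobiEpsilon t q)
      ((-q ^ 4 + 3 * q ^ 2 - 2) + 2 * (q ^ 4 - q ^ 2 + 1) * (1 - q ^ 2 * sn t q ^ 2)) t := by
  refine (((hasDerivAt_id t).const_mul (-q ^ 4 + 3 * q ^ 2 - 2)).add
    ((hasDerivAt_jacobiEpsilon hq t).const_mul (2 * (q ^ 4 - q ^ 2 + 1)))).congr_deriv ?_
  rw [dn_sq hq]; ring

lemma hasDerivAt_u₂ (hq : q ^ 2 < 1) (t : ℝ) : HasDerivAt (u₂ q) (u₂Deriv q t) t := by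
  have hS := (hasDerivAt_sn_sq hq t).const_sub 1
  have h := ((((hS.const_mul (-2 * q ^ 6 + 3 * q ^ 4 - 5 * q ^ 2 + 2)).const_add (-1 + q ^ 2)).add
    ((hS.pow 2).const_mul (2 * q ^ 2 * (q ^ 4 - q ^ 2 + 1)))).add
    ((hasDerivAt_lameCoeff hq t).mul (hasDerivAt_u₁ hq t)))
  refine (h.congr_of_eventuallyEq (Filter.Eventually.of_forall fun s => u₂_eq q s)).congr_deriv ?_
  rw [u₂Deriv]
  simp; ring

lemma hasDerivAt_u₂Deriv (hq : q ^ 2 < 1) (t : ℝ) :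
    HasDerivAt (u₂Deriv q) ((-4 * (1 + q ^ 2) + 12 * q ^ 2 * sn t q ^ 2) * u₂ q t) t := by
  have hS := hasDerivAt_sn_sq hq t
  have h := ((((((hS.const_sub 1).const_mul (8 * q ^ 2 * (q ^ 4 - q ^ 2 + 1))).const_sub
    (-2 * (-2 * q ^ 6 + 3 * q ^ 4 - 5 * q ^ 2 + 2))).add_const (-q ^ 4 + 3 * q ^ 2 - 2)).add
    (((hS.const_mul (q ^ 2)).const_sub 1).const_mul (2 * (q ^ 4 - q ^ 2 + 1)))).mul
      (hasDerivAt_u₁ hq t)).add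
    ((hasDerivAt_lameCoeff hq t).mul (hasDerivAt_u₁Deriv hq t))
  refine h.congr_deriv ?_
  have h1 := u₁_sq hq t
  rw [u₂_eq, u₁Deriv]
  simp only [Pi.add_apply]
  generalize sn t q = s at *
  generalize u₁ q t = u at *
  -- The multiplier is the coefficient of `u₁²`, which appears when the polynomial factor of `u₁` in
  -- `u₂Deriv` is differentiated.
  linear_combination (12 * q ^ 2 * (q ^ 4 - q ^ 2 + 1)) * h1

/-- The terms containing `t` and the Epsilon function cancel, since they enter `u₂` as a multiple of
`u₁` and `u₂Deriv` as the same multiple of `u₁Deriv`. What is left is polynomial in `sn²` after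
`u₁²` is eliminated. -/
lemma wronskian_u (hq : q ^ 2 < 1) (t : ℝ) :
    u₁ q t * u₂Deriv q t - u₁Deriv q t * u₂ q t = -(1 - q ^ 2) ^ 2 := by
  have h1 := u₁_sq hq t
  rw [u₂_eq, u₂Deriv, u₁Deriv]
  generalize sn t q = s at *
  generalize u₁ q t = u at *
  generalize jacobiEpsilon t q = E at *
  linear_combination (-2 * (-2 * q ^ 6 + 3 * q ^ 4 - 5 * q ^ 2 + 2)
      - 8 * q ^ 2 * (q ^ 4 - q ^ 2 + 1) * (1 - s ^ 2)
      + (-q ^ 4 + 3 * q ^ 2 - 2) + 2 * (q ^ 4 - q ^ 2 + 1) * (1 - q ^ 2 * s ^ 2)) * h1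

end Lame

/-! ### The explicit solution of the unperturbed equation -/

section Deterministic

/-- Uniqueness for `f̈ = g f` with vanishing initial data. -/
lemma eq_zero_of_linear_second_order {f f' g : ℝ → ℝ} (hg : ContinuousOn g (Ici 0))
    (h0 : f 0 = 0) (h0' : f' 0 = 0)
    (hf : ∀ t, 0 ≤ t → HasDerivWithinAt f (f' t) (Ici 0) t)
    (hf' : ∀ t, 0 ≤ t → HasDerivWithinAt f' (g t * f t) (Ici 0) t) {t : ℝ} (ht : 0 ≤ t) :
    f t = 0 := by
  obtain ⟨K, hK⟩ := isCompact_Icc.exists_bound_of_continuousOn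
    (hg.mono (Icc_subset_Ici_self : Icc 0 t ⊆ Ici 0))
  have hK0 : 0 ≤ K := (norm_nonneg _).trans (hK 0 ⟨le_rfl, ht⟩)
  have hc : ∀ {h h' : ℝ → ℝ}, (∀ t, 0 ≤ t → HasDerivWithinAt h (h' t) (Ici 0) t) →
      ContinuousOn h (Icc 0 t) := fun hh s hs =>
    (hh s hs.1).continuousWithinAt.mono Icc_subset_Ici_self
  -- The pair `(f, f')` solves a linear first-order system whose Lipschitz constant in the sup
  -- metric is `max 1 (sup |g|)`; the zero pair solves it too.
  have key := ODE_solution_unique_of_mem_Icc_right (a := 0) (b := t)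
    (v := fun s (p : ℝ × ℝ) => (p.2, g s * p.1)) (s := fun _ => univ)
    (f := fun s => (f s, f' s)) (g := fun _ => 0) (K := (max 1 K).toNNReal) ?_
    ((hc hf).prodMk (hc hf')) (fun s hs => ((hf s hs.1).prodMk (hf' s hs.1)).mono
      (Ici_subset_Ici.2 hs.1))
    (fun _ _ => mem_univ _) continuousOn_const
    (fun s _ => (hasDerivWithinAt_const s (Ici s) (0 : ℝ × ℝ)).congr_deriv (by ext <;> simp))
    (fun _ _ => mem_univ _) (by simp [h0, h0'])
  · simpa using congrArg Prod.fst (key (right_mem_Icc.2 ht))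
  · intro s hs
    refine (LipschitzWith.of_dist_le_mul fun p p' => ?_).lipschitzOnWith
    rw [Real.coe_toNNReal _ (le_max_of_le_left zero_le_one), Prod.dist_eq, Prod.dist_eq]
    refine max_le ?_ ?_
    · calc _ ≤ max (dist p.1 p'.1) (dist p.2 p'.2) := le_max_right _ _
        _ ≤ _ := le_mul_of_one_le_left (le_max_of_le_left dist_nonneg) (le_max_left _ _)
    · calc dist (g s * p.1) (g s * p'.1) = |g s| * dist p.1 p'.1 := by
            rw [Real.dist_eq, ← mul_sub, abs_mul, Real.dist_eq]
        _ ≤ _ := mul_le_mul ((hK s ⟨hs.1, hs.2.le⟩).trans (le_max_right _ _)) (le_max_left _ _)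
            dist_nonneg (le_max_of_le_left zero_le_one)

/-- Solutions of `ẍ = x² - 𝓑` on `[0, ∞)` are determined by their initial data. -/
lemma IsDeterministicSolution.unique {𝓑 y η : ℝ} {x z : ℝ → ℝ}
    (hx : IsDeterministicSolution 𝓑 y η x) (hz : IsDeterministicSolution 𝓑 y η z)
    {t : ℝ} (ht : 0 ≤ t) : x t = z t := by
  obtain ⟨ξ, hx0, hξ0, hx⟩ := hx
  obtain ⟨ζ, hz0, hζ0, hz⟩ := hz
  -- Since `x² - z² = (x + z)(x - z)`, the difference solves a linear equation with coefficient `x +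
  -- z`.
  have := eq_zero_of_linear_second_order (f := fun t => x t - z t) (f' := fun t => ξ t - ζ t)
    (g := fun t => x t + z t)
    (fun s hs => (hx s hs).1.continuousWithinAt.add (hz s hs).1.continuousWithinAt)
    (by simp [hx0, hz0]) (by simp [hξ0, hζ0])
    (fun s hs => (hx s hs).1.sub (hz s hs).1)
    (fun s hs => ((hx s hs).2.sub (hz s hs).2).congr_deriv (by ring)) ht
  exact sub_eq_zero.1 this

variable {a c y η : ℝ}

lemma modulus_sq (hcb : c < -a - c) (hba : -a - c < a) :
    modulus a c ^ 2 = (2 * c + a) / (c - a) :=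
  Real.sq_sqrt (div_nonneg_of_nonpos (by linarith) (by linarith))

lemma modulus_sq_lt_one (hcb : c < -a - c) (hba : -a - c < a) : modulus a c ^ 2 < 1 := by
  rw [modulus_sq hcb hba, div_lt_one_of_neg (by linarith)]
  linarith

lemma ellipticF_neg (φ q : ℝ) : ellipticF (-φ) q = -ellipticF φ q := by
  have h := intervalIntegral.integral_comp_neg (a := 0) (b := φ)
    fun α : ℝ => 1 / √(1 - q ^ 2 * Real.sin α ^ 2)
  simp only [Real.sin_neg, neg_sq, neg_zero] at h
  rw [ellipticF, ellipticF, h, intervalIntegral.integral_symm]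

lemma am_phase (hcb : c < -a - c) (hba : -a - c < a) :
    am (phase a c y η) (modulus a c) =
      if 0 ≤ η then Real.arcsin √((c - y) / (2 * c + a))
      else -Real.arcsin √((c - y) / (2 * c + a)) := by
  have hq := modulus_sq_lt_one hcb hba
  unfold phase
  split_ifs
  · rw [am_ellipticF hq]
  · rw [← ellipticF_neg, am_ellipticF hq]

lemma phase_ratio_mem (hcb : c < -a - c) (hy : y ∈ Icc c (-a - c)) :
    (c - y) / (2 * c + a) ∈ Icc 0 1 := by
  refine ⟨div_nonneg_of_nonpos (by linarith [hy.1]) (by linarith), ?_⟩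
  rw [div_le_one_of_neg (by linarith)]
  linarith [hy.2]

lemma sn_phase (hcb : c < -a - c) (hba : -a - c < a) (hy : y ∈ Icc c (-a - c)) :
    sn (phase a c y η) (modulus a c) =
      if 0 ≤ η then √((c - y) / (2 * c + a)) else -√((c - y) / (2 * c + a)) := by
  have hr := phase_ratio_mem hcb hy
  have h1 : -1 ≤ √((c - y) / (2 * c + a)) := by linarith [Real.sqrt_nonneg ((c - y) / (2 * c + a))]
  rw [sn, am_phase hcb hba]
  split_ifs
  · exact Real.sin_arcsin h1 (Real.sqrt_le_one.2 hr.2)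
  · rw [Real.sin_neg, Real.sin_arcsin h1 (Real.sqrt_le_one.2 hr.2)]

lemma cn_phase_nonneg (hcb : c < -a - c) (hba : -a - c < a) :
    0 ≤ cn (phase a c y η) (modulus a c) := by
  rw [cn, am_phase hcb hba]
  split_ifs <;> try simp only [Real.cos_neg]
  all_goals exact Real.cos_arcsin_nonneg _

lemma sn_phase_sq (hcb : c < -a - c) (hba : -a - c < a) (hy : y ∈ Icc c (-a - c)) :
    sn (phase a c y η) (modulus a c) ^ 2 = (c - y) / (2 * c + a) := by
  rw [sn_phase hcb hba hy]
  split_ifs <;> try simp only [neg_sq]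
  all_goals exact Real.sq_sqrt (phase_ratio_mem hcb hy).1

/-- Conservation of energy makes both squares equal to `2/3 (y - c)(y + a + c)(y - a)`. The signs
agree because the branch in `phase` gives `sn` the sign of `η`, while `cn`, `dn` and `-(2c + a)` are
nonnegative. -/
lemma velocity_phase (hcb : c < -a - c) (hba : -a - c < a) (hy : y ∈ Icc c (-a - c))
    (hη : hamiltonian (bConst a c) y η = a * c * (a + c) / 3) :
    -(2 * c + a) * (2 * u₁ (modulus a c) (phase a c y η) * √((a - c) / 6)) = η := by
  have hq := modulus_sq_lt_one hcb hba
  have hac : 0 < a - c := by linarith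
  have hk : √((a - c) / 6) ^ 2 = (a - c) / 6 := Real.sq_sqrt (by positivity)
  have hsq : (-(2 * c + a) * (2 * u₁ (modulus a c) (phase a c y η) * √((a - c) / 6))) ^ 2
      = η ^ 2 := by
    have h1 : 2 * c + a ≠ 0 := by linarith
    have h2 : c - a ≠ 0 := by linarith
    simp only [hamiltonian, bConst] at hη
    calc _ = (2 * c + a) ^ 2 * 4 * u₁ (modulus a c) (phase a c y η) ^ 2 * √((a - c) / 6) ^ 2 := by
          ring
      _ = 2 / 3 * (y - c) * (y + a + c) * (y - a) := by
          rw [hk, u₁_sq hq, sn_phase_sq hcb hba hy, modulus_sq hcb hba]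
          field_simp
          ring
      _ = η ^ 2 := by linear_combination -2 * hη
  have hd := dn_pos hq (phase a c y η)
  have hcn := cn_phase_nonneg (y := y) (η := η) hcb hba
  have hs := sn_phase (η := η) hcb hba hy
  have hr := Real.sqrt_nonneg ((c - y) / (2 * c + a))
  have hk0 := Real.sqrt_nonneg ((a - c) / 6)
  have hca : 0 ≤ -(2 * c + a) := by linarith
  by_cases h : 0 ≤ η
  · rw [if_pos h] at hs
    have : 0 ≤ u₁ (modulus a c) (phase a c y η) := by rw [u₁, hs]; positivity
    exact (sq_eq_sq₀ (by positivity) h).1 hsq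
  · rw [if_neg h] at hs
    have : 0 ≤ -u₁ (modulus a c) (phase a c y η) := by
      rw [u₁, hs, neg_mul, neg_mul, neg_neg]; positivity
    rw [← neg_inj, ← sq_eq_sq₀ _ (by linarith), neg_sq, neg_sq, hsq]
    have : 0 ≤ -(2 * c + a) * (2 * -u₁ (modulus a c) (phase a c y η) * √((a - c) / 6)) := by
      positivity
    linarith

lemma hasDerivAt_phase (a c y η t : ℝ) :
    HasDerivAt (fun t => √((a - c) / 6) * t + phase a c y η) √((a - c) / 6) t := by
  simpa using ((hasDerivAt_id t).const_mul √((a - c) / 6)).add_const (phase a c y η)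

lemma isDeterministicSolution_sn (hcb : c < -a - c) (hba : -a - c < a) (hy : y ∈ Icc c (-a - c))
    (hη : hamiltonian (bConst a c) y η = a * c * (a + c) / 3) :
    IsDeterministicSolution (bConst a c) y η fun t =>
      c - (2 * c + a) * sn (√((a - c) / 6) * t + phase a c y η) (modulus a c) ^ 2 := by
  have hq := modulus_sq_lt_one hcb hba
  have hac : 0 < a - c := by linarith
  have hk : √((a - c) / 6) ^ 2 = (a - c) / 6 := Real.sq_sqrt (by positivity)
  have h1 : 2 * c + a ≠ 0 := by linarith
  have h2 : c - a ≠ 0 := by linarith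
  refine ⟨fun t => -(2 * c + a) * (2 * u₁ (modulus a c) (√((a - c) / 6) * t + phase a c y η)
    * √((a - c) / 6)), ?_, ?_, fun t _ => ⟨HasDerivAt.hasDerivWithinAt ?_,
      HasDerivAt.hasDerivWithinAt ?_⟩⟩
  · simp only [mul_zero, zero_add, sn_phase_sq hcb hba hy]
    linear_combination -div_mul_cancel₀ (c - y) h1
  · simpa using velocity_phase hcb hba hy hη
  · refine ((((hasDerivAt_sn_sq hq _).comp t (hasDerivAt_phase a c y η t)).const_mul
      (2 * c + a)).const_sub c).congr_deriv ?_
    ring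
  · refine (((((hasDerivAt_u₁ hq _).comp t (hasDerivAt_phase a c y η t)).const_mul 2).mul_const
      √((a - c) / 6)).const_mul (-(2 * c + a))).congr_deriv ?_
    rw [u₁Deriv, modulus_sq hcb hba, bConst]
    beta_reduce
    generalize sn _ _ = s
    calc _ = -(2 * c + a) * 2 * (1 - 2 * (1 + (2 * c + a) / (c - a)) * s ^ 2
          + 3 * ((2 * c + a) / (c - a)) * (s ^ 2) ^ 2) * √((a - c) / 6) ^ 2 := by ring
      _ = _ := by
        rw [hk]
        field_simp
        ring

/-- `w₁` and `w₂` solve `ẅ = 2 x₀ w` on `[0, ∞)` and have Wronskian `1`. -/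
theorem exists_derivs_w (hcb : c < -a - c) (hba : -a - c < a) (hy : y ∈ Icc c (-a - c))
    (hη : hamiltonian (bConst a c) y η = a * c * (a + c) / 3) {x₀ : ℝ → ℝ}
    (hx₀ : IsDeterministicSolution (bConst a c) y η x₀) {κ₁ κ₂ : ℝ}
    (hκ : κ₁ * κ₂ * (-√((a - c) / 6) * (1 - modulus a c ^ 2) ^ 2) = 1) :
    ∃ v₁ v₂ : ℝ → ℝ, (∀ t, HasDerivAt (w₁ a c y η κ₁) (v₁ t) t) ∧
      (∀ t, HasDerivAt (w₂ a c y η κ₂) (v₂ t) t) ∧ Continuous v₁ ∧ Continuous v₂ ∧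
      (∀ t, 0 ≤ t → HasDerivAt v₁ (2 * x₀ t * w₁ a c y η κ₁ t) t) ∧
      (∀ t, 0 ≤ t → HasDerivAt v₂ (2 * x₀ t * w₂ a c y η κ₂ t) t) ∧
      ∀ t, w₁ a c y η κ₁ t * v₂ t - v₁ t * w₂ a c y η κ₂ t = 1 := by
  have hq := modulus_sq_lt_one hcb hba
  have hac : 0 < a - c := by linarith
  have hk : √((a - c) / 6) ^ 2 = (a - c) / 6 := Real.sq_sqrt (by positivity)
  have h2 : c - a ≠ 0 := by linarith
  -- By uniqueness `x₀` is the elliptic solution, and `2 x₀` is the rescaled Lamé potential. This is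
  -- known only for `t ≥ 0`, where `x₀` is prescribed.
  have hpot : ∀ t, 0 ≤ t → 2 * x₀ t = √((a - c) / 6) ^ 2 * (-4 * (1 + modulus a c ^ 2)
      + 12 * modulus a c ^ 2 * sn (√((a - c) / 6) * t + phase a c y η) (modulus a c) ^ 2) := by
    intro t ht
    rw [hx₀.unique (isDeterministicSolution_sn hcb hba hy hη) ht, hk, modulus_sq hcb hba]
    field_simp
    ring
  have hD₁ : ∀ t, HasDerivAt (fun t => κ₁ * (u₁Deriv (modulus a c)
      (√((a - c) / 6) * t + phase a c y η) * √((a - c) / 6))) _ t := fun t =>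
    ((((hasDerivAt_u₁Deriv hq _).comp t (hasDerivAt_phase a c y η t)).mul_const
      √((a - c) / 6)).const_mul κ₁)
  have hD₂ : ∀ t, HasDerivAt (fun t => κ₂ * (u₂Deriv (modulus a c)
      (√((a - c) / 6) * t + phase a c y η) * √((a - c) / 6))) _ t := fun t =>
    ((((hasDerivAt_u₂Deriv hq _).comp t (hasDerivAt_phase a c y η t)).mul_const
      √((a - c) / 6)).const_mul κ₂)
  refine ⟨_, _, fun t => ((hasDerivAt_u₁ hq _).comp t (hasDerivAt_phase a c y η t)).const_mul κ₁,
    fun t => ((hasDerivAt_u₂ hq _).comp t (hasDerivAt_phase a c y η t)).const_mul κ₂,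
    continuous_iff_continuousAt.2 fun t => (hD₁ t).continuousAt,
    continuous_iff_continuousAt.2 fun t => (hD₂ t).continuousAt,
    fun t ht => (hD₁ t).congr_deriv ?_, fun t ht => (hD₂ t).congr_deriv ?_, fun t => ?_⟩
  · rw [hpot t ht, w₁]; ring
  · rw [hpot t ht, w₂]; ring
  · rw [w₁, w₂]
    have := wronskian_u hq (√((a - c) / 6) * t + phase a c y η)
    linear_combination κ₁ * κ₂ * √((a - c) / 6) * this + hκ

end Deterministic

/-! ### Maximal inequality for sums of independent centred variables -/

section Probability

/-- This is the source of the factor `√(2/π)`. Evenness reduces the integral to a half-line, where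
it is a Gamma integral at `1`. -/
lemma integral_abs_gaussianReal (v : ℝ≥0) :
    ∫ x, |x| ∂(gaussianReal 0 v) = √(2 / Real.pi) * √v := by
  by_cases hv : v = 0
  · simp [hv]
  have hv' : (0 : ℝ) < v := by positivity
  rw [integral_gaussianReal_eq_integral_smul hv, gaussianPDFReal_def]
  have h1 := integral_rpow_mul_exp_neg_mul_rpow (p := 2) (q := 1) (b := (2 * v : ℝ)⁻¹)
    (by norm_num) (by norm_num) (by positivity)
  have h2 := integral_comp_abs
    (f := fun x : ℝ => (√(2 * Real.pi * v))⁻¹ * Real.exp (-(2 * v : ℝ)⁻¹ * x ^ (2 : ℝ)) * x)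
  calc _ = ∫ x : ℝ, (√(2 * Real.pi * v))⁻¹ * Real.exp (-(2 * v : ℝ)⁻¹ * |x| ^ (2 : ℝ)) * |x| := by
        refine integral_congr_ae (Filter.Eventually.of_forall fun x => ?_)
        simp only [smul_eq_mul, sub_zero, Real.rpow_two, sq_abs]
        congr 3
        field_simp
    _ = 2 * ((√(2 * Real.pi * v))⁻¹ * ∫ x in Ioi (0 : ℝ),
          x ^ (1 : ℝ) * Real.exp (-(2 * v : ℝ)⁻¹ * x ^ (2 : ℝ))) := by
        rw [h2, ← integral_const_mul (√(2 * Real.pi * v))⁻¹]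
        congr 1
        refine setIntegral_congr_fun measurableSet_Ioi fun x _ => ?_
        simp only [Real.rpow_one]
        ring
    _ = 2 * ((√(2 * Real.pi * v))⁻¹ * v) := by
        rw [h1]
        rw [show ((1 : ℝ) + 1) / 2 = 1 by norm_num, show -((1 : ℝ) + 1) / 2 = -1 by norm_num,
          Real.Gamma_one, Real.rpow_neg_one, inv_inv]
        ring
    _ = _ := by
        have h3 : √(v : ℝ) ^ 2 = v := Real.sq_sqrt hv'.le
        have h4 : √(2 : ℝ) ^ 2 = 2 := Real.sq_sqrt (by norm_num)
        rw [Real.sqrt_mul (by positivity), Real.sqrt_mul (by norm_num), Real.sqrt_div (by norm_num)]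
        have h5 : 0 < √(v : ℝ) := Real.sqrt_pos.2 hv'
        have h6 : 0 < √(2 : ℝ) := Real.sqrt_pos.2 (by norm_num)
        have h7 : 0 < √Real.pi := Real.sqrt_pos.2 Real.pi_pos
        field_simp
        rw [h3, h4]

variable {Ω : Type*} {mΩ : MeasurableSpace Ω} {P : Measure Ω}

lemma hasLaw_sum_gaussianReal {D : ℕ → Ω → ℝ} {v : ℕ → ℝ≥0} (hm : ∀ j, Measurable (D j))
    (hind : iIndepFun D P) (hlaw : ∀ j, HasLaw (D j) (gaussianReal 0 (v j)) P) (n : ℕ) :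
    HasLaw (fun ω => ∑ j ∈ Finset.range n, D j ω) (gaussianReal 0 (∑ j ∈ Finset.range n, v j)) P := by
  have : IsProbabilityMeasure P := hind.isProbabilityMeasure
  refine ⟨(Finset.measurable_fun_sum _ fun j _ => hm j).aemeasurable, ?_⟩
  induction n with
  | zero => simp [gaussianReal_zero_var]
  | succ n ih =>
    have h := gaussianReal_add_gaussianReal_of_indepFun
      (hind.indepFun_sum_range_succ hm n)
      (by simpa only [← Finset.sum_apply] using! ih) (hlaw n).map_eq
    rw [add_zero] at h
    rw [Finset.sum_range_succ, ← h]
    congr 1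
    ext ω
    simp [Finset.sum_range_succ]

/-- Doob's maximal inequality for the partial sums of independent centred variables. -/
lemma measure_exists_le_abs_sum {D : ℕ → Ω → ℝ} (hm : ∀ j, Measurable (D j))
    (hind : iIndepFun D P) (hint : ∀ j, Integrable (D j) P) (hmean : ∀ j, ∫ ω, D j ω ∂P = 0)
    {M : ℝ} (hM : 0 < M) (N : ℕ) :
    P {ω | ∃ k ≤ N, M ≤ |∑ j ∈ Finset.range (k + 1), D j ω|} ≤
      ENNReal.ofReal ((∫ ω, |∑ j ∈ Finset.range (N + 1), D j ω| ∂P) / M) := by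
  have : IsProbabilityMeasure P := hind.isProbabilityMeasure
  have hsm : ∀ j, StronglyMeasurable (D j) := fun j => (hm j).stronglyMeasurable
  let 𝒢 := Filtration.natural D hsm
  let S : ℕ → Ω → ℝ := fun k => ∑ j ∈ Finset.range (k + 1), D j
  have hSint : ∀ k, Integrable (S k) P := fun k => integrable_finsetSum' _ fun j _ => hint j
  have hSadp : StronglyAdapted 𝒢 S := fun k =>
    Finset.stronglyMeasurable_sum _ fun j hj =>
      (Filtration.stronglyAdapted_natural hsm j).mono
        (𝒢.mono (Nat.lt_succ_iff.1 (Finset.mem_range.1 hj)))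
  have hmart : Martingale S 𝒢 P := by
    refine martingale_nat hSadp hSint fun k => ?_
    have h1 : S (k + 1) = S k + D (k + 1) := Finset.sum_range_succ _ _
    have h2 : P[D (k + 1) | 𝒢 k] =ᵐ[P] fun _ => P[D (k + 1)] :=
      hind.condExp_natural_ae_eq_of_lt hsm (Nat.lt_succ_self k)
    have h3 : P[S k | 𝒢 k] = S k :=
      condExp_of_stronglyMeasurable (𝒢.le k) (hSadp k) (hSint k)
    rw [h1]
    filter_upwards [condExp_add (hSint k) (hint (k + 1)) (𝒢 k), h2] with ω hω hω'
    rw [hω, Pi.add_apply, h3, hω', hmean, add_zero]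
  -- `|S|` is written as `S ⊔ -S`, a supremum of two martingales, hence a submartingale.
  have hsub := hmart.submartingale.sup hmart.neg.submartingale
  have hmax := maximal_ineq (ε := M.toNNReal) hsub (fun k ω => by
    exact abs_nonneg (S k ω)) N
  have hset : {ω | ∃ k ≤ N, M ≤ |∑ j ∈ Finset.range (k + 1), D j ω|} =
      {ω | ((M.toNNReal : ℝ≥0) : ℝ) ≤ (Finset.range (N + 1)).sup' Finset.nonempty_range_add_one
        fun k => (S ⊔ -S) k ω} := by
    ext ω
    simp only [mem_ofPred_eq, Finset.le_sup'_iff, Finset.mem_range, Nat.lt_succ_iff,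
      Real.coe_toNNReal M hM.le]
    simp [S, abs, Finset.sum_apply]
  rw [hset, ENNReal.ofReal_div_of_pos hM, ENNReal.le_div_iff_mul_le (by simp [hM]) (by simp),
    mul_comm]
  refine hmax.trans (ENNReal.ofReal_le_ofReal ?_)
  have habs : (S ⊔ -S) N = fun ω => |∑ j ∈ Finset.range (N + 1), D j ω| := by
    ext ω
    simp [S, abs, Finset.sum_apply]
  rw [habs]
  refine setIntegral_le_integral ?_ (Filter.Eventually.of_forall fun ω => abs_nonneg _)
  exact (integrable_finsetSum _ fun j _ => hint j).abs

/-- The set is the increasing union of the tail intersections, each of measure at most `C`. This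
allows the mesh beyond which Riemann sums are accurate to depend on `ω`. -/
lemma measure_eventually_le {A : ℕ → Set Ω} {c : ℕ → ℝ≥0∞} {C : ℝ≥0∞} (hA : ∀ n, P (A n) ≤ c n)
    (hc : Filter.Tendsto c Filter.atTop (nhds C)) :
    P {ω | ∀ᶠ n in Filter.atTop, ω ∈ A n} ≤ C := by
  have hset : {ω | ∀ᶠ n in Filter.atTop, ω ∈ A n} = ⋃ m, ⋂ n ≥ m, A n := by
    ext ω; simp [Filter.eventually_atTop]
  have hmono : Monotone fun m => ⋂ n ≥ m, A n := fun m m' hm =>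
    biInter_subset_biInter_left fun n (hn : m' ≤ n) => hm.trans hn
  rw [hset, hmono.measure_iUnion]
  refine iSup_le fun m => ge_of_tendsto hc ?_
  filter_upwards [Filter.eventually_ge_atTop m] with n hn
  exact (measure_mono (biInter_subset_of_mem hn)).trans (hA n)

end Probability

/-! ### Riemann sums -/

section Riemann

/-- Used to compare sums with integrals: an error of `δ` per mesh cell accumulates linearly. -/
lemma abs_le_of_abs_sub_le {A : ℕ → ℝ} {δ : ℝ} {n : ℕ} (h0 : A 0 = 0)
    (h : ∀ i < n, |A (i + 1) - A i| ≤ δ) : ∀ i ≤ n, |A i| ≤ i * δ := by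
  intro i
  induction i with
  | zero => simp [h0]
  | succ i ih =>
    intro hi
    have h1 := ih (by omega)
    have h2 := h i (by omega)
    have h3 := abs_add_le (A (i + 1) - A i) (A i)
    rw [sub_add_cancel] at h3
    push_cast
    linarith

lemma eventually_mesh {f : ℝ → ℝ} (hf : Continuous f) (T : ℝ) {ε : ℝ} (hε : 0 < ε) :
    ∀ᶠ N : ℕ in Filter.atTop, ∀ s ∈ Icc 0 T, ∀ t ∈ Icc 0 T, |s - t| ≤ T / (N + 1) →
      |f s - f t| ≤ ε := by
  obtain ⟨δ, hδ, h⟩ := Metric.uniformContinuousOn_iff.1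
    (isCompact_Icc.uniformContinuousOn_of_continuous hf.continuousOn : UniformContinuousOn f
      (Icc 0 T)) ε hε
  have ht : Filter.Tendsto (fun N : ℕ => T / ((N : ℝ) + 1)) Filter.atTop (nhds 0) :=
    tendsto_const_div_atTop_nhds_zero_nat T |>.comp (Filter.tendsto_add_atTop_nat 1) |>.congr
      fun N => by simp
  filter_upwards [ht.eventually_lt_const hδ] with N hN s hs t ht hst
  exact (h s hs t ht (hst.trans_lt hN)).le

lemma mesh_mem {T : ℝ} (hT : 0 ≤ T) {N i : ℕ} (hi : i ≤ N + 1) :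
    (i : ℝ) * (T / (N + 1)) ∈ Icc 0 T := by
  refine ⟨by positivity, ?_⟩
  have : (i : ℝ) ≤ N + 1 := by exact_mod_cast hi
  calc (i : ℝ) * (T / (N + 1)) ≤ (N + 1) * (T / (N + 1)) := by gcongr
    _ = T := by field_simp

lemma tendsto_riemann_sum {f : ℝ → ℝ} (hf : Continuous f) {T : ℝ} (hT : 0 < T) :
    Filter.Tendsto (fun N : ℕ => ∑ j ∈ Finset.range (N + 1),
      f (j * (T / (N + 1))) * (T / (N + 1))) Filter.atTop (nhds (∫ s in (0 : ℝ)..T, f s)) := by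
  rw [Metric.tendsto_nhds]
  intro ε hε
  filter_upwards [eventually_mesh hf T (ε := ε / (2 * T)) (by positivity)] with N hN
  set h := T / ((N : ℝ) + 1) with hh
  have hpos : 0 < h := by positivity
  have hNh : ((N : ℝ) + 1) * h = T := by rw [hh]; field_simp
  have key := abs_le_of_abs_sub_le (n := N + 1) (δ := ε / (2 * T) * h)
    (A := fun i => ∑ j ∈ Finset.range i, f (j * h) * h - ∫ s in (0 : ℝ)..(i * h), f s)
    (by simp) (fun i hi => ?_) (N + 1) le_rfl
  · rw [Real.dist_eq]
    simp only [Nat.cast_add, Nat.cast_one, hNh] at key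
    refine key.trans_lt ?_
    have : ((N : ℝ) + 1) * (ε / (2 * T) * h) = ε / 2 := by
      rw [mul_left_comm, hNh]; field_simp
    rw [this]; linarith
  · have h1 := intervalIntegral.integral_add_adjacent_intervals (μ := volume)
      (hf.intervalIntegrable 0 (i * h)) (hf.intervalIntegrable (i * h) ((i + 1 : ℕ) * h))
    have h2 : (∑ j ∈ Finset.range (i + 1), f (j * h) * h - ∫ s in (0 : ℝ)..((i + 1 : ℕ) * h), f s)
        - (∑ j ∈ Finset.range i, f (j * h) * h - ∫ s in (0 : ℝ)..(i * h), f s)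
        = ∫ s in (i * h)..((i + 1 : ℕ) * h), (f (i * h) - f s) := by
      rw [intervalIntegral.integral_sub (by simp) (hf.intervalIntegrable _ _), ← h1,
        Finset.sum_range_succ, intervalIntegral.integral_const, smul_eq_mul]
      push_cast; ring
    rw [h2, ← Real.norm_eq_abs]
    refine (intervalIntegral.norm_integral_le_of_norm_le_const (C := ε / (2 * T))
      fun s hs => ?_).trans (le_of_eq ?_)
    · rw [uIoc_of_le (by push_cast; nlinarith)] at hs
      have m1 := mesh_mem hT.le (N := N) (i := i) (by omega)
      have m2 := mesh_mem hT.le (N := N) (i := i + 1) (by omega)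
      refine hN _ m1 _ ⟨m1.1.trans hs.1.le, hs.2.trans m2.2⟩ ?_
      have := hs.2
      push_cast at this
      rw [abs_le]
      constructor <;> nlinarith [hs.1]
    · push_cast
      rw [show ((i : ℝ) + 1) * h - i * h = h by ring, abs_of_pos hpos]

/-- The stochastic integral `∫₀ᵗ w db` along a continuous path `b`, defined through integration
by parts. -/
noncomputable def pathIntegral (w w' b : ℝ → ℝ) (t : ℝ) : ℝ :=
  w t * b t - ∫ s in (0 : ℝ)..t, w' s * b s

variable {w w' b : ℝ → ℝ}

lemma continuous_pathIntegral (hw : Continuous w) (hw' : Continuous w') (hb : Continuous b) :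
    Continuous (pathIntegral w w' b) :=
  (hw.mul hb).sub (intervalIntegral.continuous_primitive
    (fun _ _ => (hw'.mul hb).intervalIntegrable _ _) 0)

lemma eventually_abs_sum_sub_pathIntegral_le (hw : ∀ t, HasDerivAt w (w' t) t)
    (hw' : Continuous w') (hb : Continuous b) (hb0 : b 0 = 0) {T : ℝ} (hT : 0 < T) {ε : ℝ}
    (hε : 0 < ε) :
    ∀ᶠ N : ℕ in Filter.atTop, ∀ i ≤ N + 1,
      |∑ j ∈ Finset.range i, w (j * (T / (N + 1))) *
          (b ((j + 1 : ℕ) * (T / (N + 1))) - b (j * (T / (N + 1))))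
        - pathIntegral w w' b (i * (T / (N + 1)))| ≤ ε := by
  obtain ⟨C, hC⟩ := isCompact_Icc.exists_bound_of_continuousOn
    (hw'.continuousOn : ContinuousOn w' (Icc 0 T))
  have hC0 : 0 ≤ C := (norm_nonneg _).trans (hC 0 ⟨le_rfl, hT.le⟩)
  -- Using `C + 1` keeps the denominator positive when `C = 0`.
  filter_upwards [eventually_mesh hb T (ε := ε / ((C + 1) * T)) (by positivity)] with N hN i hi
  set h := T / ((N : ℝ) + 1) with hh
  have hpos : 0 < h := by positivity
  have hNh : ((N : ℝ) + 1) * h = T := by rw [hh]; field_simp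
  have key := abs_le_of_abs_sub_le (n := N + 1) (δ := C * (ε / ((C + 1) * T)) * h)
    (A := fun i => ∑ j ∈ Finset.range i, w (j * h) * (b ((j + 1 : ℕ) * h) - b (j * h))
      - pathIntegral w w' b (i * h))
    (by simp [pathIntegral, hb0]) (fun i hi => ?_) i hi
  · refine key.trans ?_
    have hi' : (i : ℝ) ≤ N + 1 := by exact_mod_cast hi
    calc (i : ℝ) * (C * (ε / ((C + 1) * T)) * h)
        ≤ (N + 1) * ((C + 1) * (ε / ((C + 1) * T)) * h) := by gcongr; linarith
      _ = ((N + 1) * h) * ((C + 1) * (ε / ((C + 1) * T))) := by ring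
      _ = ε := by rw [hNh]; field_simp
  · have hwb : Continuous fun s => w' s * b s := hw'.mul hb
    have h1 := intervalIntegral.integral_add_adjacent_intervals (μ := volume)
      (hwb.intervalIntegrable 0 (i * h)) (hwb.intervalIntegrable (i * h) ((i + 1 : ℕ) * h))
    have h3 := intervalIntegral.integral_eq_sub_of_hasDerivAt (f := w) (f' := w')
      (a := i * h) (b := (i + 1 : ℕ) * h) (fun s _ => hw s) (hw'.intervalIntegrable _ _)
    -- Integration by parts on one cell leaves `w'` against the oscillation of `b` from the right
    -- endpoint, so continuity of `b` suffices.
    have h2 : (∑ j ∈ Finset.range (i + 1), w (j * h) * (b ((j + 1 : ℕ) * h) - b (j * h))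
          - pathIntegral w w' b ((i + 1 : ℕ) * h))
        - (∑ j ∈ Finset.range i, w (j * h) * (b ((j + 1 : ℕ) * h) - b (j * h))
          - pathIntegral w w' b (i * h))
        = ∫ s in (i * h)..((i + 1 : ℕ) * h), w' s * (b s - b ((i + 1 : ℕ) * h)) := by
      simp only [mul_sub]
      rw [intervalIntegral.integral_sub (hwb.intervalIntegrable _ _)
        ((hw'.mul_const _).intervalIntegrable _ _), intervalIntegral.integral_mul_const,
        h3, pathIntegral, pathIntegral, ← h1, Finset.sum_range_succ]
      ring
    rw [h2, ← Real.norm_eq_abs]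
    refine (intervalIntegral.norm_integral_le_of_norm_le_const (C := C * (ε / ((C + 1) * T)))
      fun s hs => ?_).trans (le_of_eq ?_)
    · rw [uIoc_of_le (by push_cast; nlinarith)] at hs
      have m1 := mesh_mem hT.le (N := N) (i := i) (by omega)
      have m2 := mesh_mem hT.le (N := N) (i := i + 1) (by omega)
      have ms : s ∈ Icc 0 T := ⟨m1.1.trans hs.1.le, hs.2.trans m2.2⟩
      rw [norm_mul]
      refine mul_le_mul (hC s ms) (hN _ ms _ m2 ?_) (norm_nonneg _) hC0
      have := hs.2
      have := hs.1
      push_cast at *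
      rw [abs_le]
      constructor <;> nlinarith
    · push_cast
      rw [show ((i : ℝ) + 1) * h - i * h = h by ring, abs_of_pos hpos]

/-- If `|∫₀ᵗ w db|` exceeds `M` somewhere, so do the Riemann sums on fine meshes. -/
lemma eventually_exists_le_abs_sum (hw : ∀ t, HasDerivAt w (w' t) t)
    (hw' : Continuous w') (hb : Continuous b) (hb0 : b 0 = 0) {T : ℝ} (hT : 0 < T) {M : ℝ}
    (hM : 0 < M) {t : ℝ} (ht : t ∈ Icc 0 T) (h : M < |pathIntegral w w' b t|) :
    ∀ᶠ N : ℕ in Filter.atTop, ∃ k ≤ N, M ≤ |∑ j ∈ Finset.range (k + 1), w (j * (T / (N + 1))) *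
          (b ((j + 1 : ℕ) * (T / (N + 1))) - b (j * (T / (N + 1))))| := by
  have hwc : Continuous w := continuous_iff_continuousAt.2 fun t => (hw t).continuousAt
  have hI := (continuous_pathIntegral hwc hw' hb).abs
  -- Half of the excess over `M` pays for replacing `t` by the grid point to its left, half for the
  -- Riemann sum error.
  set ε := (|pathIntegral w w' b t| - M) / 2 with hεd
  have hε : 0 < ε := by rw [hεd]; linarith
  filter_upwards [eventually_abs_sum_sub_pathIntegral_le hw hw' hb hb0 hT hε,
    eventually_mesh hI T hε] with N h1 h2
  have hpos : 0 < T / ((N : ℝ) + 1) := by positivity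
  have hNh : ((N : ℝ) + 1) * (T / (N + 1)) = T := by field_simp
  generalize T / ((N : ℝ) + 1) = δ at *
  set i := ⌊t / δ⌋₊ with hi
  have hi1 : (i : ℝ) ≤ t / δ := Nat.floor_le (div_nonneg ht.1 hpos.le)
  have hi2 : t / δ < i + 1 := Nat.lt_floor_add_one _
  rw [le_div_iff₀ hpos] at hi1
  rw [div_lt_iff₀ hpos] at hi2
  have hiN : i ≤ N + 1 := by
    have : (i : ℝ) ≤ N + 1 := le_of_mul_le_mul_right (by linarith [ht.2]) hpos
    exact_mod_cast this
  have h3 := h1 i hiN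
  have h4 := h2 t ht (i * δ) ⟨by positivity, hi1.trans ht.2⟩
    (by rw [abs_le]; constructor <;> linarith)
  have h5 : M ≤ |∑ j ∈ Finset.range i, w (j * δ) * (b ((j + 1 : ℕ) * δ) - b (j * δ))| := by
    have h6 := (abs_le.1 h4).2
    have h7 := abs_sub_abs_le_abs_sub (pathIntegral w w' b (i * δ))
      (∑ j ∈ Finset.range i, w (j * δ) * (b ((j + 1 : ℕ) * δ) - b (j * δ)))
    rw [abs_sub_comm] at h3
    have : |pathIntegral w w' b t| = M + 2 * ε := by rw [hεd]; ring
    linarith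
  -- The index is not `0`: the empty sum cannot reach `M > 0`.
  obtain ⟨k, hk⟩ : ∃ k, i = k + 1 := by
    refine Nat.exists_eq_succ_of_ne_zero fun h0 => ?_
    rw [h0] at h5
    simp at h5
    linarith
  rw [hk] at h5 hiN
  exact ⟨k, by omega, h5⟩

end Riemann

/-! ### The maximal inequality for Wiener integrals -/

section Wiener

variable {Ω : Type*} {mΩ : MeasurableSpace Ω} {P : Measure Ω} {B : ℝ≥0 → Ω → ℝ}

lemma l2Norm_eq_sqrt {w : ℝ → ℝ} (hw : Continuous w) {T : ℝ} (hT : 0 ≤ T) :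
    l2Norm w T = √(∫ s in (0 : ℝ)..T, w s ^ 2) := by
  have hmem : MemLp w 2 (volume.restrict (Icc 0 T)) :=
    (memLp_two_iff_integrable_sq hw.aestronglyMeasurable).2
      ((hw.pow 2).continuousOn.integrableOn_Icc)
  rw [l2Norm, hmem.eLpNorm_eq_integral_rpow_norm (by norm_num) (by norm_num),
    ENNReal.toReal_ofReal (by positivity), intervalIntegral.integral_of_le hT,
    ← integral_Icc_eq_integral_Ioc, Real.sqrt_eq_rpow]
  simp

/-- The maximal inequality for the Wiener integral of a `C¹` function. -/
theorem measure_exists_lt_abs_pathIntegral (hBm : ∀ t, Measurable (B t)) (hB : IsBrownianReal B P)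
    {w w' : ℝ → ℝ} (hw : ∀ t, HasDerivAt w (w' t) t) (hw' : Continuous w') {T : ℝ} (hT : 0 < T)
    {M : ℝ} (hM : 0 < M) :
    P {ω | ∃ t ∈ Icc 0 T, M < |pathIntegral w w' (fun s => B s.toNNReal ω) t|} ≤
      ENNReal.ofReal (√(2 / Real.pi) * l2Norm w T / M) := by
  have hwc : Continuous w := continuous_iff_continuousAt.2 fun t => (hw t).continuousAt
  let A : ℕ → Set Ω := fun N => {ω | ∃ k ≤ N, M ≤ |∑ j ∈ Finset.range (k + 1),
    w (j * (T / (N + 1))) * (B ((j + 1 : ℕ) * (T / (N + 1)) : ℝ).toNNReal ω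
      - B (j * (T / (N + 1)) : ℝ).toNNReal ω)|}
  let R : ℕ → ℝ := fun N => ∑ j ∈ Finset.range (N + 1),
    w (j * (T / (N + 1))) ^ 2 * (T / (N + 1))
  have hA : ∀ N, P (A N) ≤ ENNReal.ofReal (√(2 / Real.pi) * √(R N) / M) := by
    intro N
    have hpos : 0 < T / ((N : ℝ) + 1) := by positivity
    simp only [A, R]
    generalize T / ((N : ℝ) + 1) = δ at *
    have hmono : Monotone fun j : ℕ => ((j : ℝ) * δ).toNNReal := fun i j hij =>
      Real.toNNReal_le_toNNReal (by gcongr)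
    -- For deterministic `w`, the weighted increments are independent centred Gaussians with
    -- variances `w² δ`; these variances add up to the Riemann sum `R N` of `∫ w²`.
    have hind := (hB.hasIndepIncrements.nat hmono).comp (fun j x => w (j * δ) * x)
      fun j => measurable_const_mul _
    have hm : ∀ j : ℕ, Measurable fun ω => w (j * δ) *
        (B ((j + 1 : ℕ) * δ : ℝ).toNNReal ω - B (j * δ : ℝ).toNNReal ω) := fun j =>
      ((hBm _).sub (hBm _)).const_mul _
    have hlaw : ∀ j : ℕ, HasLaw (fun ω => w (j * δ) *
        (B ((j + 1 : ℕ) * δ : ℝ).toNNReal ω - B (j * δ : ℝ).toNNReal ω))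
        (gaussianReal 0 (w (j * δ) ^ 2 * δ).toNNReal) P := by
      intro j
      have h := gaussianReal_const_mul (hB.hasLaw_sub ((j + 1 : ℕ) * δ : ℝ).toNNReal
        (j * δ : ℝ).toNNReal) (w (j * δ))
      rw [mul_zero] at h
      convert! h using 2
      ext
      rw [Real.coe_toNNReal _ (by positivity)]
      simp only [NNReal.coe_mul, NNReal.coe_mk, coe_nndist, Real.dist_eq]
      rw [Real.toNNReal_of_nonneg (by positivity), Real.toNNReal_of_nonneg (by positivity)]
      simp only [NNReal.val_eq_coe, NNReal.coe_mk]
      congr 1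
      push_cast
      rw [show ((j : ℝ) + 1) * δ - j * δ = δ by ring, abs_of_pos hpos]
    have hmax := measure_exists_le_abs_sum hm hind (fun j => (hlaw j).hasGaussianLaw.integrable)
      (fun j => by rw [(hlaw j).integral_eq, integral_id_gaussianReal]) hM N
    refine hmax.trans (le_of_eq ?_)
    have hsum := hasLaw_sum_gaussianReal hm hind hlaw (N + 1)
    have h1 := hsum.integral_comp (f := fun x : ℝ => |x|) (by fun_prop)
    simp only [Function.comp_def] at h1
    rw [h1, integral_abs_gaussianReal, NNReal.coe_sum]
    congr 4
    refine Finset.sum_congr rfl fun j _ => Real.coe_toNNReal _ (by positivity)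
  have hlim : Filter.Tendsto (fun N => ENNReal.ofReal (√(2 / Real.pi) * √(R N) / M)) Filter.atTop
      (nhds (ENNReal.ofReal (√(2 / Real.pi) * l2Norm w T / M))) := by
    rw [l2Norm_eq_sqrt hwc hT.le]
    exact ENNReal.tendsto_ofReal
      (((tendsto_riemann_sum (hwc.pow 2) hT).sqrt.const_mul _).div_const _)
  refine (measure_mono_ae ?_).trans (measure_eventually_le hA hlim)
  filter_upwards [hB.cont, hB.eval_zero_ae_eq_zero] with ω hc h0
  rintro ⟨t, ht, h⟩
  exact eventually_exists_le_abs_sum hw hw' (hc.comp continuous_real_toNNReal)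
    (by simpa using h0) hT hM ht h

end Wiener

/-! ### Variation of constants along a path -/

section Pathwise

lemma intervalIntegrable_of_continuousOn_Ici {g : ℝ → ℝ} (hg : ContinuousOn g (Ici 0)) {t : ℝ}
    (ht : 0 ≤ t) : IntervalIntegrable g volume 0 t :=
  (hg.mono (by rw [uIcc_of_le ht]; exact Icc_subset_Ici_self)).intervalIntegrable

lemma hasDerivAt_primitive {g : ℝ → ℝ} (hg : ContinuousOn g (Ici 0)) {t : ℝ} (ht : 0 < t) :
    HasDerivAt (fun t => ∫ s in (0 : ℝ)..t, g s) (g t) t :=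
  intervalIntegral.integral_hasDerivAt_right (intervalIntegrable_of_continuousOn_Ici hg ht.le)
    (ContinuousOn.stronglyMeasurableAtFilter isOpen_Ioi (hg.mono Ioi_subset_Ici_self) t ht)
    (hg.continuousAt (Ici_mem_nhds ht))

variable {x₀ x ξ F b w v w₁ w₂ v₁ v₂ : ℝ → ℝ} {θ : ℝ}

/-- Pairing a solution of `ẍ = 2 x₀ x + F + θ ḃ` with a solution of `ẅ = 2 x₀ w`. -/
lemma wronskian_eq_integral (hx₀ : ContinuousOn x₀ (Ici 0)) (hx : ContinuousOn x (Ici 0))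
    (hξ : ContinuousOn ξ (Ici 0)) (hF : ContinuousOn F (Ici 0)) (hb : Continuous b)
    (hw : ∀ t, HasDerivAt w (v t) t) (hvc : Continuous v)
    (hv : ∀ t, 0 ≤ t → HasDerivAt v (2 * x₀ t * w t) t) (hb0 : b 0 = 0)
    (hxi : ∀ t, 0 ≤ t → x t = ∫ s in (0 : ℝ)..t, ξ s)
    (hξi : ∀ t, 0 ≤ t → ξ t = (∫ s in (0 : ℝ)..t, (2 * x₀ s * x s + F s)) + θ * b t)
    {t : ℝ} (ht : 0 ≤ t) :
    w t * ξ t - v t * x t = (∫ s in (0 : ℝ)..t, w s * F s) + θ * pathIntegral w v b t := by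
  have hwc : Continuous w := continuous_iff_continuousAt.2 fun t => (hw t).continuousAt
  have hwF : ContinuousOn (fun s => w s * F s) (Ici 0) := hwc.continuousOn.mul hF
  have hvb : Continuous fun s => θ * (v s * b s) := (hvc.mul hb).const_mul θ
  have hdrift : ContinuousOn (fun s => 2 * x₀ s * x s + F s) (Ici 0) :=
    ((hx₀.const_mul 2).mul hx).add hF
  -- `ξ` need not be differentiable, but `ξ - θ b` is. In the derivative of `w (ξ - θ b) - v x` the
  -- terms with `x₀` cancel, and `w F - θ v b` remains.
  have key := intervalIntegral.integral_eq_sub_of_hasDerivAt_of_le (a := 0) (b := t)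
    (f := fun s => w s * (ξ s - θ * b s) - v s * x s)
    (f' := fun s => w s * F s - θ * (v s * b s)) ht ?_ ?_
    ((intervalIntegrable_of_continuousOn_Ici hwF ht).sub (hvb.intervalIntegrable _ _))
  · have hx0 : x 0 = 0 := by simpa using hxi 0 le_rfl
    have hξ0 : ξ 0 = 0 := by simpa [hb0] using hξi 0 le_rfl
    rw [intervalIntegral.integral_sub (intervalIntegrable_of_continuousOn_Ici hwF ht)
      (hvb.intervalIntegrable _ _), intervalIntegral.integral_const_mul] at key
    simp only [hx0, hξ0, hb0] at key
    rw [pathIntegral]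
    linear_combination -key
  · exact ((hwc.continuousOn.mul (hξ.sub (hb.const_mul θ).continuousOn)).sub
      (hvc.continuousOn.mul hx)).mono Icc_subset_Ici_self
  · intro s hs
    have hnhds : ∀ᶠ r in nhds s, 0 ≤ r := Ici_mem_nhds hs.1
    have h1 : HasDerivAt x (ξ s) s := (hasDerivAt_primitive hξ hs.1).congr_of_eventuallyEq
      (hnhds.mono fun r hr => hxi r hr)
    have h2 : HasDerivAt (fun r => ξ r - θ * b r) (2 * x₀ s * x s + F s) s :=
      (hasDerivAt_primitive hdrift hs.1).congr_of_eventuallyEq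
        (hnhds.mono fun r hr => by simp only [hξi r hr, add_sub_cancel_right])
    refine (((hw s).mul h2).sub ((hv s hs.1.le).mul h1)).congr_deriv ?_
    ring

/-- A path driven by `b` is the difference of two integrals against `b`. -/
lemma eq_pathIntegral_sub (hx₀ : ContinuousOn x₀ (Ici 0)) (hx : ContinuousOn x (Ici 0))
    (hξ : ContinuousOn ξ (Ici 0)) (hb : Continuous b)
    (hw₁ : ∀ t, HasDerivAt w₁ (v₁ t) t) (hw₂ : ∀ t, HasDerivAt w₂ (v₂ t) t)
    (hvc₁ : Continuous v₁) (hvc₂ : Continuous v₂)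
    (hv₁ : ∀ t, 0 ≤ t → HasDerivAt v₁ (2 * x₀ t * w₁ t) t)
    (hv₂ : ∀ t, 0 ≤ t → HasDerivAt v₂ (2 * x₀ t * w₂ t) t)
    (hW : ∀ t, w₁ t * v₂ t - v₁ t * w₂ t = 1) (hb0 : b 0 = 0)
    (hxi : ∀ t, 0 ≤ t → x t = ∫ s in (0 : ℝ)..t, ξ s)
    (hξi : ∀ t, 0 ≤ t → ξ t = (∫ s in (0 : ℝ)..t, 2 * x₀ s * x s) + b t)
    {t : ℝ} (ht : 0 ≤ t) :
    x t = w₂ t * pathIntegral w₁ v₁ b t - w₁ t * pathIntegral w₂ v₂ b t := by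
  have hξi' : ∀ t, 0 ≤ t → ξ t = (∫ s in (0 : ℝ)..t, (2 * x₀ s * x s + 0)) + 1 * b t := by
    simpa using hξi
  have h1 := wronskian_eq_integral hx₀ hx hξ continuousOn_const hb hw₁ hvc₁ hv₁ hb0 hxi hξi' ht
  have h2 := wronskian_eq_integral hx₀ hx hξ continuousOn_const hb hw₂ hvc₂ hv₂ hb0 hxi hξi' ht
  simp only [mul_zero, intervalIntegral.integral_zero, zero_add, one_mul] at h1 h2
  rw [← h1, ← h2]
  -- Eliminating `ξ` between the two pairings leaves `x` times the Wronskian.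
  linear_combination -x t * hW t

/-- The variation of constants formula. -/
lemma eq_integral_kernelK (hx₀ : ContinuousOn x₀ (Ici 0)) (hx : ContinuousOn x (Ici 0))
    (hξ : ContinuousOn ξ (Ici 0)) (hF : ContinuousOn F (Ici 0))
    (hw₁ : ∀ t, HasDerivAt w₁ (v₁ t) t) (hw₂ : ∀ t, HasDerivAt w₂ (v₂ t) t)
    (hvc₁ : Continuous v₁) (hvc₂ : Continuous v₂)
    (hv₁ : ∀ t, 0 ≤ t → HasDerivAt v₁ (2 * x₀ t * w₁ t) t)
    (hv₂ : ∀ t, 0 ≤ t → HasDerivAt v₂ (2 * x₀ t * w₂ t) t)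
    (hW : ∀ t, w₁ t * v₂ t - v₁ t * w₂ t = 1)
    (hxi : ∀ t, 0 ≤ t → x t = ∫ s in (0 : ℝ)..t, ξ s)
    (hξi : ∀ t, 0 ≤ t → ξ t = ∫ s in (0 : ℝ)..t, (2 * x₀ s * x s + F s))
    {t : ℝ} (ht : 0 ≤ t) :
    x t = ∫ s in (0 : ℝ)..t, kernelK w₁ w₂ t s * F s := by
  have hξi' : ∀ t, 0 ≤ t → ξ t = (∫ s in (0 : ℝ)..t, (2 * x₀ s * x s + F s)) + 0 * (0 : ℝ) := by
    simpa using hξi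
  have h1 := wronskian_eq_integral hx₀ hx hξ hF continuous_const hw₁ hvc₁ hv₁ rfl hxi hξi' ht
  have h2 := wronskian_eq_integral hx₀ hx hξ hF continuous_const hw₂ hvc₂ hv₂ rfl hxi hξi' ht
  simp only [zero_mul, add_zero] at h1 h2
  have hint : ∀ {w v : ℝ → ℝ}, (∀ t, HasDerivAt w (v t) t) →
      IntervalIntegrable (fun s => w s * F s) volume 0 t := fun {w v} hw =>
    intervalIntegrable_of_continuousOn_Ici
      ((continuous_iff_continuousAt.2 fun t => (hw t).continuousAt).continuousOn.mul hF) ht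
  have h3 : ∫ s in (0 : ℝ)..t, kernelK w₁ w₂ t s * F s
      = w₂ t * (∫ s in (0 : ℝ)..t, w₁ s * F s) - w₁ t * ∫ s in (0 : ℝ)..t, w₂ s * F s := by
    rw [← intervalIntegral.integral_const_mul, ← intervalIntegral.integral_const_mul,
      ← intervalIntegral.integral_sub ((hint hw₁).const_mul _) ((hint hw₂).const_mul _)]
    refine intervalIntegral.integral_congr fun s _ => ?_
    simp only [kernelK]
    ring
  rw [h3, ← h1, ← h2]
  linear_combination -x t * hW t

/-! ### The bounds `γₙ` -/

lemma continuous_kernelK (hw₁ : Continuous w₁) (hw₂ : Continuous w₂) :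
    Continuous fun p : ℝ × ℝ => kernelK w₁ w₂ p.1 p.2 := by
  unfold kernelK
  fun_prop

lemma continuous_gammaBound (hw₁ : Continuous w₁) (hw₂ : Continuous w₂) (n : ℕ) :
    Continuous (gammaBound w₁ w₂ n) := by
  induction n using Nat.strong_induction_on with
  | _ n ih =>
    rcases lt_or_ge n 2 with hn | hn
    · interval_cases n
      · have : gammaBound w₁ w₂ 0 = fun _ => 0 := by rw [gammaBound]
        rw [this]; exact continuous_const
      · have : gammaBound w₁ w₂ 1 = fun t => |w₁ t| + |w₂ t| := by rw [gammaBound]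
        rw [this]; exact hw₁.abs.add hw₂.abs
    · rw [funext (gammaBound_of_two_le w₁ w₂ n hn)]
      refine intervalIntegral.continuous_parametric_intervalIntegral_of_continuous
        (f := fun t s => |kernelK w₁ w₂ t s| *
          ∑ j ∈ Finset.Icc 1 (n - 1), gammaBound w₁ w₂ j s * gammaBound w₁ w₂ (n - j) s)
        ?_ continuous_id
      refine (continuous_kernelK hw₁ hw₂).abs.mul (continuous_finsetSum _ fun j hj => ?_)
      rw [Finset.mem_Icc] at hj
      exact ((ih j (by omega)).mul (ih (n - j) (by omega))).comp continuous_snd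

/-- If `|X₁| ≤ M γ₁` and the `Xₙ` satisfy the recursion, then `|Xₙ| ≤ Mⁿ γₙ`. -/
lemma abs_le_pow_mul_gammaBound (hw₁ : Continuous w₁) (hw₂ : Continuous w₂) {X : ℕ → ℝ → ℝ}
    {M T : ℝ} (h1 : ∀ t ∈ Icc 0 T, |X 1 t| ≤ M * gammaBound w₁ w₂ 1 t)
    (hX : ∀ n, 2 ≤ n → ∀ t, 0 ≤ t → X n t = ∫ s in (0 : ℝ)..t, kernelK w₁ w₂ t s *
      ∑ j ∈ Finset.Icc 1 (n - 1), X j s * X (n - j) s) (n : ℕ) (hn : 1 ≤ n) :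
    ∀ t ∈ Icc 0 T, |X n t| ≤ M ^ n * gammaBound w₁ w₂ n t := by
  induction n using Nat.strong_induction_on with
  | _ n ih =>
    intro t ht
    obtain rfl | hn2 := hn.eq_or_lt
    · simpa using h1 t ht
    rw [hX n hn2 t ht.1, gammaBound_of_two_le w₁ w₂ n hn2, ← intervalIntegral.integral_const_mul,
      ← Real.norm_eq_abs]
    refine intervalIntegral.norm_integral_le_of_norm_le ht.1
      (Filter.Eventually.of_forall fun s hs => ?_) (Continuous.intervalIntegrable ?_ _ _)
    · have hsT : s ∈ Icc 0 T := ⟨hs.1.le, hs.2.trans ht.2⟩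
      rw [norm_mul, Real.norm_eq_abs, mul_left_comm]
      refine mul_le_mul_of_nonneg_left ?_ (abs_nonneg _)
      rw [Finset.mul_sum]
      refine norm_sum_le_of_le _ fun j hj => ?_
      rw [Finset.mem_Icc] at hj
      have hj1 := ih j (by omega) hj.1 s hsT
      have hj2 := ih (n - j) (by omega) (by omega) s hsT
      rw [norm_mul]
      refine (mul_le_mul hj1 hj2 (abs_nonneg _) ((abs_nonneg _).trans hj1)).trans (le_of_eq ?_)
      -- Homogeneity: each product in the recursion has total degree `n`.
      have hpow : M ^ n = M ^ j * M ^ (n - j) := by rw [← pow_add]; congr 1; omega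
      rw [hpow]; ring
    · have hg := continuous_gammaBound hw₁ hw₂
      have hK : Continuous fun s => kernelK w₁ w₂ t s :=
        (continuous_kernelK hw₁ hw₂).comp (Continuous.prodMk_right t)
      exact continuous_const.mul (hK.abs.mul
        (continuous_finsetSum _ fun j _ => (hg j).mul (hg _)))

end Pathwise

/-! ### The coefficients of the expansion -/

section Expansion

variable {Ω : Type*} {mΩ : MeasurableSpace Ω} {P : Measure Ω} {B : ℝ≥0 → Ω → ℝ}
  {x₀ : ℝ → ℝ} {x : ℕ → ℝ → Ω → ℝ} {w₁ w₂ v₁ v₂ : ℝ → ℝ}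

lemma IsDeterministicSolution.continuousOn {𝓑 y η : ℝ} (hx : IsDeterministicSolution 𝓑 y η x₀) :
    ContinuousOn x₀ (Ici 0) := by
  obtain ⟨_, _, _, h⟩ := hx
  exact fun t ht => (h t ht).1.continuousWithinAt

lemma IsExpansion.isBrownianAdapted (hx : IsExpansion P B x₀ x) {n : ℕ} (hn : 1 ≤ n) :
    IsBrownianAdapted P B (x n) := by
  obtain rfl | hn := hn.eq_or_lt
  · exact hx.first.choose_spec.1
  · exact (hx.higher n hn).choose_spec.1

lemma IsBrownianAdapted.aemeasurable (hBm : ∀ t, Measurable (B t)) {z : ℝ → Ω → ℝ}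
    (hz : IsBrownianAdapted P B z) {t : ℝ} (ht : 0 ≤ t) : AEMeasurable (z t) P := by
  have hle : brownianSigma B ⟨t, ht⟩ ≤ mΩ := iSup_le fun s => (hBm s).comap_le
  exact ((hz ⟨t, ht⟩).mono hle).aemeasurable

lemma IsExpansion.ae_continuousOn (hx : IsExpansion P B x₀ x) :
    ∀ᵐ ω ∂P, ∀ n, 1 ≤ n → ContinuousOn (fun t => x n t ω) (Ici 0) := by
  rw [ae_all_iff]
  intro n
  rw [Filter.eventually_imp_distrib_left]
  intro hn
  obtain rfl | hn := hn.eq_or_lt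
  · obtain ⟨_, _, _, h⟩ := hx.first
    filter_upwards [h] with ω hω using hω.1
  · obtain ⟨_, _, _, h⟩ := hx.higher n hn
    filter_upwards [h] with ω hω using hω.1

lemma IsExpansion.ae_first_eq (hx : IsExpansion P B x₀ x) (hB : IsBrownianReal B P)
    (hx₀ : ContinuousOn x₀ (Ici 0))
    (hw₁ : ∀ t, HasDerivAt w₁ (v₁ t) t) (hw₂ : ∀ t, HasDerivAt w₂ (v₂ t) t)
    (hvc₁ : Continuous v₁) (hvc₂ : Continuous v₂)
    (hv₁ : ∀ t, 0 ≤ t → HasDerivAt v₁ (2 * x₀ t * w₁ t) t)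
    (hv₂ : ∀ t, 0 ≤ t → HasDerivAt v₂ (2 * x₀ t * w₂ t) t)
    (hW : ∀ t, w₁ t * v₂ t - v₁ t * w₂ t = 1) :
    ∀ᵐ ω ∂P, ∀ t, 0 ≤ t → x 1 t ω = w₂ t * pathIntegral w₁ v₁ (fun s => B s.toNNReal ω) t
      - w₁ t * pathIntegral w₂ v₂ (fun s => B s.toNNReal ω) t := by
  obtain ⟨ξ, _, _, h⟩ := hx.first
  filter_upwards [h, hB.cont, hB.eval_zero_ae_eq_zero] with ω ⟨hc, hc', hi⟩ hcB h0 t ht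
  refine eq_pathIntegral_sub (x := fun t => x 1 t ω) (ξ := fun t => ξ t ω) hx₀ hc hc'
    (hcB.comp continuous_real_toNNReal) hw₁ hw₂ hvc₁ hvc₂ hv₁ hv₂ hW (by simpa using h0)
    (fun t ht => (hi ⟨t, ht⟩).1) (fun t ht => ?_) ht
  have := (hi ⟨t, ht⟩).2
  rw [one_mul] at this
  simpa [Real.toNNReal_of_nonneg ht] using! this

lemma IsExpansion.ae_higher_eq (hx : IsExpansion P B x₀ x) (hx₀ : ContinuousOn x₀ (Ici 0))
    (hw₁ : ∀ t, HasDerivAt w₁ (v₁ t) t) (hw₂ : ∀ t, HasDerivAt w₂ (v₂ t) t)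
    (hvc₁ : Continuous v₁) (hvc₂ : Continuous v₂)
    (hv₁ : ∀ t, 0 ≤ t → HasDerivAt v₁ (2 * x₀ t * w₁ t) t)
    (hv₂ : ∀ t, 0 ≤ t → HasDerivAt v₂ (2 * x₀ t * w₂ t) t)
    (hW : ∀ t, w₁ t * v₂ t - v₁ t * w₂ t = 1) :
    ∀ᵐ ω ∂P, ∀ n, 2 ≤ n → ∀ t, 0 ≤ t → x n t ω = ∫ s in (0 : ℝ)..t, kernelK w₁ w₂ t s *
      ∑ j ∈ Finset.Icc 1 (n - 1), x j s ω * x (n - j) s ω := by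
  rw [ae_all_iff]
  intro n
  rw [Filter.eventually_imp_distrib_left]
  intro hn
  obtain ⟨ξ, _, _, h⟩ := hx.higher n hn
  filter_upwards [h, hx.ae_continuousOn] with ω ⟨hc, hc', hi⟩ hcx t ht
  refine eq_integral_kernelK (x := fun t => x n t ω) (ξ := fun t => ξ t ω)
    (F := fun s => ∑ j ∈ Finset.Icc 1 (n - 1), x j s ω * x (n - j) s ω) hx₀ hc hc'
    (continuousOn_finsetSum _ fun j hj => ?_) hw₁ hw₂ hvc₁ hvc₂ hv₁ hv₂ hW
    (fun t ht => (hi ⟨t, ht⟩).1) (fun t ht => ?_) ht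
  · rw [Finset.mem_Icc] at hj
    exact (hcx j hj.1).mul (hcx (n - j) (by omega))
  · have := (hi ⟨t, ht⟩).2
    rw [zero_mul, add_zero] at this
    exact this

/-- The growth estimate applies with `M = 1/σ`, so the weight `σ ^ i` cancels `M ^ i` in every term.
-/
lemma abs_truncated_sub_le {σ T : ℝ} (hσ : 0 < σ) {ω : Ω}
    (hw₁ : Continuous w₁) (hw₂ : Continuous w₂) {J₁ J₂ : ℝ → ℝ}
    (hJ₁ : ∀ t ∈ Icc 0 T, |J₁ t| ≤ 1 / σ) (hJ₂ : ∀ t ∈ Icc 0 T, |J₂ t| ≤ 1 / σ)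
    (h1 : ∀ t, 0 ≤ t → x 1 t ω = w₂ t * J₁ t - w₁ t * J₂ t)
    (h2 : ∀ n, 2 ≤ n → ∀ t, 0 ≤ t → x n t ω = ∫ s in (0 : ℝ)..t, kernelK w₁ w₂ t s *
      ∑ j ∈ Finset.Icc 1 (n - 1), x j s ω * x (n - j) s ω) (n : ℕ) :
    ∀ t ∈ Icc 0 T, |truncated x₀ x σ n t ω - x₀ t| ≤ gammaSum w₁ w₂ n t := by
  have h1' : ∀ t ∈ Icc 0 T, |x 1 t ω| ≤ 1 / σ * gammaBound w₁ w₂ 1 t := by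
    intro t ht
    have hg : gammaBound w₁ w₂ 1 t = |w₁ t| + |w₂ t| := by rw [gammaBound]
    rw [h1 t ht.1, hg]
    calc _ ≤ |w₂ t * J₁ t| + |w₁ t * J₂ t| := abs_sub _ _
      _ = |w₂ t| * |J₁ t| + |w₁ t| * |J₂ t| := by rw [abs_mul, abs_mul]
      _ ≤ |w₂ t| * (1 / σ) + |w₁ t| * (1 / σ) := by
          gcongr
          exacts [hJ₁ t ht, hJ₂ t ht]
      _ = _ := by ring
  intro t ht
  rw [truncated, add_sub_cancel_left, gammaSum]
  refine (Finset.abs_sum_le_sum_abs _ _).trans (Finset.sum_le_sum fun i hi => ?_)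
  have hb := abs_le_pow_mul_gammaBound hw₁ hw₂ (X := fun n t => x n t ω) h1' h2 i
    (Finset.mem_Icc.1 hi).1 t ht
  rw [abs_mul, abs_of_pos (pow_pos hσ i)]
  calc σ ^ i * |x i t ω| ≤ σ ^ i * ((1 / σ) ^ i * gammaBound w₁ w₂ i t) := by gcongr
    _ = gammaBound w₁ w₂ i t := by
      rw [← mul_assoc, ← mul_pow, mul_one_div_cancel hσ.ne', one_pow, one_mul]

/-- For processes with continuous paths, a pathwise upper bound on `[0, T]` is an event. -/
lemma nullMeasurableSet_forall_Icc_le {f : ℝ → Ω → ℝ} {g : ℝ → ℝ} {T : ℝ} (hT : 0 ≤ T)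
    (hf : ∀ t ∈ Icc 0 T, AEMeasurable (f t) P)
    (hfc : ∀ᵐ ω ∂P, ContinuousOn (fun t => f t ω) (Icc 0 T)) (hg : Continuous g) :
    NullMeasurableSet {ω | ∀ t ∈ Icc 0 T, f t ω ≤ g t} P := by
  -- Projecting the rationals to `[0, T]` gives a countable dense set of times, endpoints included;
  -- path continuity recovers all times.
  have hmeas : NullMeasurableSet
      {ω | ∀ r : ℚ, f (projIcc 0 T hT r) ω ≤ g (projIcc 0 T hT r)} P := by
    rw [ofPred_forall]
    exact NullMeasurableSet.iInter fun r =>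
      nullMeasurableSet_le (hf _ (projIcc 0 T hT r).2) aemeasurable_const
  refine hmeas.congr ?_
  filter_upwards [hfc] with ω hω
  refine propext ⟨fun h t ht => ?_, fun h r => h _ (projIcc 0 T hT r).2⟩
  have hproj : Continuous fun t : ℝ => (projIcc 0 T hT t : ℝ) :=
    continuous_subtype_val.comp continuous_projIcc
  have := Rat.denseRange_cast.induction_on (p := fun t : ℝ =>
    f (projIcc 0 T hT t) ω ≤ g (projIcc 0 T hT t)) t
    (isClosed_le (hω.comp_continuous hproj fun t => (projIcc 0 T hT t).2) (hg.comp hproj)) h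
  simpa [projIcc_of_mem hT ht] using this

end Expansion

end AnharmonicOscillator

/-! ### The probability estimate for the truncated expansion -/

open AnharmonicOscillator in
theorem mainTheorem2
    {Ω : Type*} {mΩ : MeasurableSpace Ω} (P : Measure Ω) [IsProbabilityMeasure P]
    (B : ℝ≥0 → Ω → ℝ) (hBm : ∀ t, Measurable (B t)) (hB : IsBrownianReal B P)
    (a c y η : ℝ) (hcb : c < -a - c) (hba : -a - c < a) (hy : y ∈ Set.Icc c (-a - c))
    (hη : AnharmonicOscillator.hamiltonian (AnharmonicOscillator.bConst a c) y η
      = a * c * (a + c) / 3)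
    (x₀ : ℝ → ℝ)
    (hx₀ : AnharmonicOscillator.IsDeterministicSolution
      (AnharmonicOscillator.bConst a c) y η x₀)
    (x : ℕ → ℝ → Ω → ℝ) (hx : AnharmonicOscillator.IsExpansion P B x₀ x)
    (κ₁ κ₂ : ℝ)
    (hκ : κ₁ * κ₂ * (-√((a - c) / 6) * (1 - AnharmonicOscillator.modulus a c ^ 2) ^ 2) = 1)
    (w₁ w₂ : ℝ → ℝ)
    (hw₁ : w₁ = AnharmonicOscillator.w₁ a c y η κ₁)
    (hw₂ : w₂ = AnharmonicOscillator.w₂ a c y η κ₂)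
    (σ : ℝ) (hσ : 0 < σ) (n : ℕ) (hn : 1 ≤ n) (T : ℝ) (hT : 0 < T) :
    NullMeasurableSet {ω | ∀ t ∈ Set.Icc 0 T,
        |AnharmonicOscillator.truncated x₀ x σ n t ω - x₀ t|
          ≤ AnharmonicOscillator.gammaSum w₁ w₂ n t} P ∧
      1 - σ * 2 ^ (n - 1) * √(2 / Real.pi)
          * (AnharmonicOscillator.l2Norm w₁ T + AnharmonicOscillator.l2Norm w₂ T)
        ≤ P.real {ω | ∀ t ∈ Set.Icc 0 T,
            |AnharmonicOscillator.truncated x₀ x σ n t ω - x₀ t|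
              ≤ AnharmonicOscillator.gammaSum w₁ w₂ n t} := by
  obtain ⟨v₁, v₂, hd₁, hd₂, hvc₁, hvc₂, hv₁, hv₂, hW⟩ := exists_derivs_w hcb hba hy hη hx₀ hκ
  rw [← hw₁] at hd₁ hv₁ hW
  rw [← hw₂] at hd₂ hv₂ hW
  have hc₁ : Continuous w₁ := continuous_iff_continuousAt.2 fun t => (hd₁ t).continuousAt
  have hc₂ : Continuous w₂ := continuous_iff_continuousAt.2 fun t => (hd₂ t).continuousAt
  have hx₀c := hx₀.continuousOn
  constructor
  · refine nullMeasurableSet_forall_Icc_le hT.le (fun t ht => ?_) ?_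
      (continuous_finsetSum _ fun i _ => continuous_gammaBound hc₁ hc₂ i)
    · simp only [truncated, add_sub_cancel_left]
      refine (Finset.aemeasurable_fun_sum _ fun i hi => ?_).abs
      exact ((hx.isBrownianAdapted (Finset.mem_Icc.1 hi).1).aemeasurable hBm ht.1).const_mul _
    · filter_upwards [hx.ae_continuousOn] with ω hω
      simp only [truncated, add_sub_cancel_left]
      exact (continuousOn_finsetSum _ fun i hi =>
        ((hω i (Finset.mem_Icc.1 hi).1).mono Icc_subset_Ici_self).const_mul _).abs
  · set S := {ω | ∀ t ∈ Set.Icc 0 T, |truncated x₀ x σ n t ω - x₀ t| ≤ gammaSum w₁ w₂ n t}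
    have hσ' : 0 < 1 / σ := by positivity
    have hP₁ := measure_exists_lt_abs_pathIntegral hBm hB hd₁ hvc₁ hT hσ'
    have hP₂ := measure_exists_lt_abs_pathIntegral hBm hB hd₂ hvc₂ hT hσ'
    have hl₁ : 0 ≤ l2Norm w₁ T := ENNReal.toReal_nonneg
    have hl₂ : 0 ≤ l2Norm w₂ T := ENNReal.toReal_nonneg
    have hcompl : P Sᶜ ≤ ENNReal.ofReal (√(2 / Real.pi) * l2Norm w₁ T / (1 / σ)
        + √(2 / Real.pi) * l2Norm w₂ T / (1 / σ)) := by
      rw [ENNReal.ofReal_add (by positivity) (by positivity)]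
      -- Almost surely, a path outside `S` must have one of the two Wiener integrals exceed `1/σ` in
      -- absolute value.
      refine le_trans ?_ ((measure_union_le _ _).trans (add_le_add hP₁ hP₂))
      refine measure_mono_ae ?_
      filter_upwards [hx.ae_first_eq hB hx₀c hd₁ hd₂ hvc₁ hvc₂ hv₁ hv₂ hW,
        hx.ae_higher_eq hx₀c hd₁ hd₂ hvc₁ hvc₂ hv₁ hv₂ hW] with ω h1 h2
      intro hω
      by_contra hnot
      have hnot := not_or.1 hnot
      refine hω (abs_truncated_sub_le hσ hc₁ hc₂ (fun t ht => ?_) (fun t ht => ?_) h1 h2 n)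
      · exact not_lt.1 fun h => hnot.1 ⟨t, ht, h⟩
      · exact not_lt.1 fun h => hnot.2 ⟨t, ht, h⟩
    have hreal : P.real Sᶜ ≤ √(2 / Real.pi) * l2Norm w₁ T / (1 / σ)
        + √(2 / Real.pi) * l2Norm w₂ T / (1 / σ) :=
      ENNReal.toReal_le_of_le_ofReal (by positivity) hcompl
    have htotal : 1 ≤ P.real S + P.real Sᶜ := by
      have := measureReal_union_le (μ := P) S Sᶜ
      rwa [union_compl_self, probReal_univ] at this
    -- The argument gives the bound without the power of `2`; that factor is at least `1` and only
    -- weakens the estimate.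
    have hpow : (1 : ℝ) ≤ 2 ^ (n - 1) := one_le_pow₀ (by norm_num)
    have hle : σ * √(2 / Real.pi) * (l2Norm w₁ T + l2Norm w₂ T)
        ≤ σ * 2 ^ (n - 1) * √(2 / Real.pi) * (l2Norm w₁ T + l2Norm w₂ T) := by
      gcongr
      exact le_mul_of_one_le_right hσ.le hpow
    have heq : √(2 / Real.pi) * l2Norm w₁ T / (1 / σ) + √(2 / Real.pi) * l2Norm w₂ T / (1 / σ)
        = σ * √(2 / Real.pi) * (l2Norm w₁ T + l2Norm w₂ T) := by
      field_simp
    linarith
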